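/- Consider a system of $N$ agents with labels $1,\dots,N$, observed from time $0$ on. Each agent $i$ holds a value $x_i(t)$: it receives one at time $0$ and a new one at each of its replacements, and keeps it in between; all attributed values are i.i.d. with mean $0$ and variance $\sigma^2<\infty$. The replacements of each agent follow a Poisson clock of rate $\lambda_r>0$, and the clocks are mutually independent. At random positive times, almost surely finitely many in bounded time, an agent $j$ sends information to an agent $i$; these exchanges may depend on each other in any way. The replacements, the exchanges and the attributed values are mutually independent. The knowledge set $K_i(t)$ of agent $i$ is the random set obtained as follows. When agent $i$ arrives at a time $t_0$ (at $t_0=0$ or by a replacement, which erases what it held before), $K_i(t_0^+)=\{(x_i(t_0),i,t_0)\}$. When agents $j$ send information to $i$ at time $\tilde t$, $$K_i(\tilde t^+)=K_i(\tilde t^-)\cup\bigcup_j\Bigl(K_j(\tilde t^-)\cup\{(x_j(\tilde t),j,\tilde t)\}\cup\{(j\to i,\tilde t)\}\Bigr),$$ where the union is over the senders $j$ at that time. Let $T_{ji}(t)=\min\{s:(x_j(t-s),j,t-s)\in K_i(t)\}$ be the age of the most recent information about $j$ available to $i$, with $T_{ji}(t)=\infty$ if there is none, and let $F_{ji}(s)=P(T_{ji}(t)\le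 s)$ be its pseudo-CDF and $f_{ji}=F_{ji}'$ its pseudo-PDF. Let $$C_{ji}(t)=\bigl(x_j(t)-\mathbb E[x_j(t)\mid K_i(t)]\bigr)^2,$$ where the conditioning is on the $\sigma$-algebra generated by the random set $K_i(t)$. **Proposition.** Let $t\ge 0$ and let $i,j$ be agents. Then $K_i(t)$ is a random set (the $\sigma$-algebra that it generates consists of events) and $C_{ji}(t)$ is integrable. If $j\ne i$ and $F_{ji}$ is absolutely continuous, then $$\mathbb E[C_{ji}(t)]=\Bigl(1-\int_0^t f_{ji}(s)\,e^{-2\lambda_r s}\,ds\Bigr)\sigma^2 .$$ If $j=i$, then $\mathbb E[C_{ii}(t)]=0$. -/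

import Mathlib

open MeasureTheory ProbabilityTheory

/-- One realization of an open system with `N` agents, labelled by `Fin N`: the successive values
attributed to each label (`value i 0` is the initial one, `value i n` the one received at the
`n`-th replacement), the waiting times between its successive replacements, and, for each ordered
pair `(j, i)`, a list of the times at which `j` sends information to `i`; the entry `⊤` stands for
an exchange that never happens, so that there may be finitely many or no exchanges. -/
structure Scenario (N : ℕ) where
  value : Fin N → ℕ → ℝ
  gap : Fin N → ℕ → ℝ
  exch : Fin N → Fin N → ℕ → EReal

/-- A piece of information: either "the value of agent `j` at time `s` is `x`", written
`Sum.inl (x, j, s)`, or "agent `j` sent information to agent `i` at time `s`", written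
`Sum.inr (j, i, s)`. -/
abbrev Info (N : ℕ) : Type := (ℝ × Fin N × ℝ) ⊕ (Fin N × Fin N × ℝ)

namespace Scenario

variable {N : ℕ}

/-- The time of the `(n + 1)`-st replacement of agent `i`. -/
noncomputable def replTime (ε : Scenario N) (i : Fin N) (n : ℕ) : ℝ :=
  ∑ k ∈ Finset.range (n + 1), ε.gap i k

/-- Agent `i` is replaced at time `s`. -/
def ReplacedAt (ε : Scenario N) (i : Fin N) (s : ℝ) : Prop :=
  ∃ n, ε.replTime i n = s

/-- Agent `j` sends information to agent `i` at time `s`. -/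
def ExchangeAt (ε : Scenario N) (j i : Fin N) (s : ℝ) : Prop :=
  ∃ n, ε.exch j i n = (s : EReal)

/-- The number of replacements of agent `i` up to time `t`. -/
noncomputable def numRepl (ε : Scenario N) (i : Fin N) (t : ℝ) : ℕ :=
  {n | ε.replTime i n ≤ t}.ncard

/-- The value `x_i(t)` held by agent `i` at time `t`. -/
noncomputable def agentValue (ε : Scenario N) (i : Fin N) (t : ℝ) : ℝ :=
  ε.value i (ε.numRepl i t)

/-- `ε.Enters i s a`: the piece of information `a` is put into the knowledge set of agent `i`
at time `s`. At its arrival (at time `0` or by a replacement) `i` learns its own value; when `j`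
sends information to `i` at time `s`, agent `i` learns the value of `j` at that time, the fact that
this exchange happens, and everything in the knowledge set of `j` just before `s`, that is,
everything that entered it at some time `r < s` and was not erased by a replacement of `j`
strictly between `r` and `s`. -/
inductive Enters (ε : Scenario N) : Fin N → ℝ → Info N → Prop
  | init (i : Fin N) : Enters ε i 0 (Sum.inl (ε.agentValue i 0, i, 0))
  | repl (i : Fin N) (s : ℝ) (h : ε.ReplacedAt i s) :
      Enters ε i s (Sum.inl (ε.agentValue i s, i, s))
  | value (j i : Fin N) (s : ℝ) (h : ε.ExchangeAt j i s) :
      Enters ε i s (Sum.inl (ε.agentValue j s, j, s))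
  | exchange (j i : Fin N) (s : ℝ) (h : ε.ExchangeAt j i s) :
      Enters ε i s (Sum.inr (j, i, s))
  | forward (j i : Fin N) (s : ℝ) (h : ε.ExchangeAt j i s) (r : ℝ) (hr : r < s) (a : Info N)
      (ha : Enters ε j r a) (hkeep : ∀ u, r < u → u < s → ¬ ε.ReplacedAt j u) :
      Enters ε i s a

/-- The knowledge set of agent `i` at time `t` (right after the events at time `t`, if any):
all the information that entered it up to time `t` and has not been erased since by a
replacement of `i`. -/
def knowledgeSet (ε : Scenario N) (i : Fin N) (t : ℝ) : Set (Info N) :=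
  {a | ∃ s ≤ t, ε.Enters i s a ∧ ∀ u, s < u → u ≤ t → ¬ ε.ReplacedAt i u}

/-- The age at time `t` of the most recent information about agent `j` available to agent `i`;
it is `⊤` if agent `i` has no information about `j`. -/
noncomputable def age (ε : Scenario N) (j i : Fin N) (t : ℝ) : EReal :=
  sInf ((fun s : ℝ => (s : EReal)) ''
    {s | (Sum.inl (ε.agentValue j (t - s), j, t - s) : Info N) ∈ ε.knowledgeSet i t})

end Scenario

/-- The measurable structure on sets of pieces of information generated by the events "the set
meets `B`", for `B` measurable; on finite sets it is the usual one, generated by the numbers of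
elements in measurable sets. -/
@[reducible] def hitMeasurableSpace (N : ℕ) : MeasurableSpace (Set (Info N)) :=
  MeasurableSpace.generateFrom
    {A | ∃ B : Set (Info N), MeasurableSet B ∧ A = {K | (K ∩ B).Nonempty}}

section Random

variable {Ω : Type*} [MeasurableSpace Ω] {N : ℕ}

/-- A random open system of `N` agents. The values are i.i.d. and centred with variance `σ ^ 2`;
the replacements of the agents follow independent Poisson clocks of rate `lam`, that is, the
waiting times are i.i.d. exponential; the information exchanges happen at positive times, finitely
many of them in bounded time, and may depend on each other in any way; the replacements are
independent of the pair (values, exchanges), and the exchanges of the pair (values,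
replacements). -/
structure IsOpenSystem (P : Measure Ω) (lam σ : ℝ) (S : Ω → Scenario N) : Prop where
  measurable_value : ∀ i n, Measurable fun ω => (S ω).value i n
  measurable_gap : ∀ i n, Measurable fun ω => (S ω).gap i n
  measurable_exch : ∀ j i n, Measurable fun ω => (S ω).exch j i n
  value_identDistrib : ∀ i n i' n',
    IdentDistrib (fun ω => (S ω).value i n) (fun ω => (S ω).value i' n') P P
  value_indep : iIndepFun (fun (p : Fin N × ℕ) ω => (S ω).value p.1 p.2) P
  value_memLp : ∀ i n, MemLp (fun ω => (S ω).value i n) 2 P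
  value_mean : ∀ i n, ∫ ω, (S ω).value i n ∂P = 0
  value_var : ∀ i n, ∫ ω, (S ω).value i n ^ 2 ∂P = σ ^ 2
  gap_law : ∀ i n, P.map (fun ω => (S ω).gap i n) = expMeasure lam
  gap_indep : iIndepFun (fun (p : Fin N × ℕ) ω => (S ω).gap p.1 p.2) P
  exch_pos : ∀ᵐ ω ∂P, ∀ j i n, 0 < (S ω).exch j i n
  exch_locallyFinite : ∀ᵐ ω ∂P, ∀ j i, ∀ t : ℝ, {n | (S ω).exch j i n ≤ (t : EReal)}.Finite
  repl_indep : IndepFun (fun ω => (S ω).gap) (fun ω => ((S ω).value, (S ω).exch)) P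
  exch_indep : IndepFun (fun ω => (S ω).exch) (fun ω => ((S ω).value, (S ω).gap)) P

/-- The information carried by the knowledge set of agent `i` at time `t`: the σ-algebra that this
random set generates. -/
@[reducible] def knowledgeSigma (S : Ω → Scenario N) (i : Fin N) (t : ℝ) : MeasurableSpace Ω :=
  (hitMeasurableSpace N).comap fun ω => (S ω).knowledgeSet i t

/-- The squared error of the optimal estimate of the value of agent `j` by agent `i`. -/
noncomputable def singleError (P : Measure Ω) (S : Ω → Scenario N) (j i : Fin N) (t : ℝ) (ω : Ω) :
    ℝ :=
  ((S ω).agentValue j t - (P[fun ω' => (S ω').agentValue j t | knowledgeSigma S i t]) ω) ^ 2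

/-- The pseudo-CDF of the age of the most recent information. -/
noncomputable def pseudoCDF (P : Measure Ω) (S : Ω → Scenario N) (j i : Fin N) (t s : ℝ) : ℝ :=
  P.real {ω | (S ω).age j i t ≤ (s : EReal)}

/-- The pseudo-PDF of the age of the most recent information. -/
noncomputable def pseudoPDF (P : Measure Ω) (S : Ω → Scenario N) (j i : Fin N) (t s : ℝ) : ℝ :=
  deriv (pseudoCDF P S j i t) s

end Random

/-! Fix `j ≠ i`. Information reaches `i` along chains of exchanges. Let L be the last time at which
`j` sends something that reaches `i` by time t without returning to `j` (`lastContact`, `⊥` if there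
is none). Which times are contacts depends only on the exchanges and on the replacements of agents
other than `j` (`contactSet_congr`). Almost surely, L is the time of the most recent information
about `j` in the knowledge set (`exists_lastContact`), and nothing that happens to `j` after L
influences that set (`AgreeUntilContact.knowledgeSet_eq`).

The conditional expectation of x_j(t) is therefore exp(-λ(t - L)) x_j(L), or 0 without contact
(`contactEstimate`, `contactEstimate_ae_eq_condExp`). It is a function of the knowledge set up to a
null set, since the latest time and value can be read off measurably. Its integrals over events of
the knowledge set are checked by fixing the index m of the holder of label `j` at time t. If this
holder was not the one present at L, the m-th value does not influence the knowledge set and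
contributes its mean 0 (`setIntegral_value_eq_zero`). If it was, the m-th waiting time can be made
long without changing the knowledge set. Memorylessness then makes surviving until t, compared with
surviving until L, cost the factor exp(-λ(t - L)) (`setIntegral_value_eq_discount`).

The mean error is thus E[x_j(t)²] minus the second moment of the estimate. The index of the holder
and the discount do not depend on the values, so both moments are multiples of σ²
(`integrable_mul_value_sq`), and squaring the discount turns λ into 2λ. The expected discount is
expressed through the pseudo-CDF by Fubini (`integral_discount`) and through its derivative by
integration by parts (`integral_pseudoPDF`). For `j = i`, the knowledge set contains the current
value. -/

namespace Scenario

/-! ### Chains of exchanges and the last contact -/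

variable {N : ℕ}

/-- `ε.Acquires k s a`: agent `k` obtains the information `a` at time `s` at first hand, that is,
not by the forwarding of a knowledge set. -/
inductive Acquires (ε : Scenario N) : Fin N → ℝ → Info N → Prop
  | init (i : Fin N) : Acquires ε i 0 (Sum.inl (ε.agentValue i 0, i, 0))
  | repl (i : Fin N) (s : ℝ) (h : ε.ReplacedAt i s) :
      Acquires ε i s (Sum.inl (ε.agentValue i s, i, s))
  | value (j i : Fin N) (s : ℝ) (h : ε.ExchangeAt j i s) :
      Acquires ε i s (Sum.inl (ε.agentValue j s, j, s))
  | exchange (j i : Fin N) (s : ℝ) (h : ε.ExchangeAt j i s) :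
      Acquires ε i s (Sum.inr (j, i, s))

/-- `ε.Carries p i t k s`: what enters the knowledge set of agent `k` at time `s` is passed on, via
agents that satisfy `p` only, to the knowledge set of agent `i` at time `t`. -/
inductive Carries (ε : Scenario N) (p : Fin N → Prop) (i : Fin N) (t : ℝ) : Fin N → ℝ → Prop
  | stay (s : ℝ) (hp : p i) (hs : s ≤ t) (hk : ∀ u, s < u → u ≤ t → ¬ ε.ReplacedAt i u) :
      Carries ε p i t i s
  | send (k k' : Fin N) (s s' : ℝ) (hp : p k) (h : ε.ExchangeAt k k' s') (hs : s < s')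
      (hk : ∀ u, s < u → u < s' → ¬ ε.ReplacedAt k u) (hc : Carries ε p i t k' s') :
      Carries ε p i t k s

theorem Acquires.enters {ε : Scenario N} {k : Fin N} {s : ℝ} {a : Info N}
    (h : ε.Acquires k s a) : ε.Enters k s a := by
  cases h with
  | init => exact .init _
  | repl _ _ h => exact .repl _ _ h
  | value _ _ _ h => exact .value _ _ _ h
  | exchange _ _ _ h => exact .exchange _ _ _ h

theorem Carries.mem_knowledgeSet {ε : Scenario N} {p : Fin N → Prop} {i k : Fin N} {t s : ℝ}
    (hc : ε.Carries p i t k s) {a : Info N} (ha : ε.Enters k s a) : a ∈ ε.knowledgeSet i t := by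
  induction hc with
  | stay s hp hs hk => exact ⟨s, hs, ha, hk⟩
  | send k k' s s' hp h hs hk hc ih => exact ih (.forward k k' s' h s hs a ha hk)

theorem Enters.exists_acquires {ε : Scenario N} {i k : Fin N} {t s : ℝ} {a : Info N}
    (ha : ε.Enters k s a) (hc : ε.Carries (fun _ => True) i t k s) :
    ∃ k s, ε.Acquires k s a ∧ ε.Carries (fun _ => True) i t k s := by
  induction ha with
  | init => exact ⟨_, _, .init _, hc⟩
  | repl _ _ h => exact ⟨_, _, .repl _ _ h, hc⟩
  | value _ _ _ h => exact ⟨_, _, .value _ _ _ h, hc⟩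
  | exchange _ _ _ h => exact ⟨_, _, .exchange _ _ _ h, hc⟩
  | forward j k s h r hr a ha hkeep ih => exact ih (.send j k r s trivial h hr hkeep hc)

/-- Unrolling the recursion separates the origin of a piece of information from its route. The route
does not depend on what is transported, so the two can be compared between scenarios and measured
separately. -/
theorem mem_knowledgeSet_iff {ε : Scenario N} {i : Fin N} {t : ℝ} {a : Info N} :
    a ∈ ε.knowledgeSet i t ↔
      ∃ k s, ε.Acquires k s a ∧ ε.Carries (fun _ => True) i t k s := by
  constructor
  · rintro ⟨s, hs, ha, hk⟩
    exact ha.exists_acquires (.stay s trivial hs hk)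
  · rintro ⟨k, s, ha, hc⟩
    exact hc.mem_knowledgeSet ha.enters

theorem Carries.le {ε : Scenario N} {p : Fin N → Prop} {i k : Fin N} {t s : ℝ}
    (hc : ε.Carries p i t k s) : s ≤ t := by
  induction hc with
  | stay s hp hs hk => exact hs
  | send k k' s s' hp h hs hk hc ih => exact hs.le.trans ih

theorem Carries.prop {ε : Scenario N} {p : Fin N → Prop} {i k : Fin N} {t s : ℝ}
    (hc : ε.Carries p i t k s) : p k := by
  cases hc <;> assumption

theorem Carries.congr {ε ε' : Scenario N} {p : Fin N → Prop}
    (hexch : ε.exch = ε'.exch)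
    (hrepl : ∀ k, p k → ∀ u, ε'.ReplacedAt k u ↔ ε.ReplacedAt k u)
    {i k : Fin N} {t s : ℝ} (hc : ε.Carries p i t k s) : ε'.Carries p i t k s := by
  induction hc with
  | stay s hp hs hk => exact .stay s hp hs fun u h1 h2 => by rw [hrepl _ hp]; exact hk u h1 h2
  | send k k' s s' hp h hs hk hc ih =>
    refine .send k k' s s' hp ?_ hs (fun u h1 h2 => by rw [hrepl _ hp]; exact hk u h1 h2) ih
    rwa [ExchangeAt, ← hexch]

/-- The times at which agent `j` sends information that reaches `i` until time `t` without
passing through `j` again. -/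
def contactSet (ε : Scenario N) (j i : Fin N) (t : ℝ) : Set ℝ :=
  {s | ∃ k, ε.ExchangeAt j k s ∧ ε.Carries (· ≠ j) i t k s}

/-- The last time at which agent `j` sends information that reaches `i` until time `t`. -/
noncomputable def lastContact (ε : Scenario N) (j i : Fin N) (t : ℝ) : EReal :=
  sSup ((fun s : ℝ => (s : EReal)) '' ε.contactSet j i t)

/-- Cut the chain where it leaves `j` for the last time: the exchange made there is a contact. The
induction runs backwards from the arrival at `i`, so the first `j` that it meets is the last one on
the chain. -/
theorem Carries.avoids_or {ε : Scenario N} {i j k : Fin N} {t s : ℝ} (hij : i ≠ j)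
    (hc : ε.Carries (fun _ => True) i t k s) :
    ε.Carries (· ≠ j) i t k s ∨ ∃ s' ∈ ε.contactSet j i t, s < s' := by
  induction hc with
  | stay s hp hs hk => exact .inl (.stay s hij hs hk)
  | send k k' s s' hp h hs hk hc ih =>
    rcases ih with ih | ⟨s'', h1, h2⟩
    · by_cases hkj : k = j
      · subst hkj
        exact .inr ⟨s', ⟨k', h, ih⟩, hs⟩
      · exact .inl (.send k k' s s' hkj h hs hk ih)
    · exact .inr ⟨s'', h1, hs.trans h2⟩

theorem le_lastContact {ε : Scenario N} {i j : Fin N} {t s : ℝ} (h : s ∈ ε.contactSet j i t) :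
    (s : EReal) ≤ ε.lastContact j i t :=
  le_sSup ⟨s, h, rfl⟩

theorem Carries.exists_contact {ε : Scenario N} {i j k : Fin N} {t s : ℝ} (hij : i ≠ j)
    (hc : ε.Carries (fun _ => True) i t k s) (h : ε.ExchangeAt j k s) :
    ∃ s' ∈ ε.contactSet j i t, s ≤ s' := by
  rcases hc.avoids_or hij with h1 | ⟨s', h1, h2⟩
  · exact ⟨s, ⟨k, h, h1⟩, le_rfl⟩
  · exact ⟨s', h1, h2.le⟩

theorem Carries.exists_contact_self {ε : Scenario N} {i j : Fin N} {t s : ℝ} (hij : i ≠ j)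
    (hc : ε.Carries (fun _ => True) i t j s) :
    ∃ s' ∈ ε.contactSet j i t, s < s' := by
  rcases hc.avoids_or hij with h1 | h
  · exact absurd rfl h1.prop
  · exact h

/-- After the contact itself the chain only visits agents other than `j`, so no condition on the
replacements of `j` is ever imposed. This makes the last contact insensitive to the clock and to the
values of `j`. -/
theorem contactSet_congr {ε ε' : Scenario N} {i j : Fin N} {t : ℝ}
    (hexch : ε.exch = ε'.exch)
    (hrepl : ∀ k, k ≠ j → ∀ u, ε'.ReplacedAt k u ↔ ε.ReplacedAt k u) :
    ε'.contactSet j i t = ε.contactSet j i t := by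
  ext s
  constructor
  · rintro ⟨k, h, hc⟩
    exact ⟨k, by rwa [ExchangeAt, hexch],
      hc.congr hexch.symm fun k hk u => (hrepl k hk u).symm⟩
  · rintro ⟨k, h, hc⟩
    exact ⟨k, by rwa [ExchangeAt, ← hexch], hc.congr hexch hrepl⟩

/-- Two scenarios that differ only in what happens to agent `j` after its last contact
with `i`. -/
structure AgreeUntilContact (ε ε' : Scenario N) (j i : Fin N) (t : ℝ) : Prop where
  exch : ε.exch = ε'.exch
  repl : ∀ k, k ≠ j → ∀ u, ε'.ReplacedAt k u ↔ ε.ReplacedAt k u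
  val : ∀ k, k ≠ j → ∀ u, ε'.agentValue k u = ε.agentValue k u
  repl_self : ∀ u : ℝ, (u : EReal) ≤ ε.lastContact j i t → (ε'.ReplacedAt j u ↔ ε.ReplacedAt j u)
  val_self : ∀ u : ℝ, (u : EReal) ≤ ε.lastContact j i t → ε'.agentValue j u = ε.agentValue j u

theorem AgreeUntilContact.symm {ε ε' : Scenario N} {i j : Fin N} {t : ℝ}
    (h : AgreeUntilContact ε ε' j i t) : AgreeUntilContact ε' ε j i t := by
  have hl : ε'.lastContact j i t = ε.lastContact j i t := by
    rw [lastContact, contactSet_congr h.exch h.repl, lastContact]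
  exact ⟨h.exch.symm, fun k hk u => (h.repl k hk u).symm, fun k hk u => (h.val k hk u).symm,
    fun u hu => (h.repl_self u (hl ▸ hu)).symm, fun u hu => (h.val_self u (hl ▸ hu)).symm⟩

/-- A chain through `j` requires `j` not to be replaced only before an exchange by `j` that reaches
`i`, hence before the last contact, where the two scenarios agree. -/
theorem AgreeUntilContact.carries {ε ε' : Scenario N} {i j k : Fin N} {t s : ℝ} (hij : i ≠ j)
    (h : AgreeUntilContact ε ε' j i t) (hc : ε.Carries (fun _ => True) i t k s) :
    ε'.Carries (fun _ => True) i t k s := by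
  induction hc with
  | stay s hp hs hk =>
    exact .stay s trivial hs fun u h1 h2 => by rw [h.repl _ hij]; exact hk u h1 h2
  | send k k' s s' hp hx hs hk hc ih =>
    refine .send k k' s s' hp ?_ hs (fun u h1 h2 => ?_) ih
    · rwa [ExchangeAt, ← h.exch]
    · by_cases hkj : k = j
      · subst hkj
        obtain ⟨v, hv, hv'⟩ := hc.exists_contact hij hx
        rw [h.repl_self u (le_trans (by exact_mod_cast h2.le.trans hv') (le_lastContact hv))]
        exact hk u h1 h2
      · rw [h.repl _ hkj]; exact hk u h1 h2

/-- Information about `j` that reaches `i` is acquired by `j` itself before a later contact, or is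
sent by `j` in an exchange no later than a contact. In both cases its date lies where the scenarios
agree. -/
theorem AgreeUntilContact.knowledgeSet_subset {ε ε' : Scenario N} {i j : Fin N} {t : ℝ}
    (hij : i ≠ j) (h : AgreeUntilContact ε ε' j i t) :
    ε.knowledgeSet i t ⊆ ε'.knowledgeSet i t := by
  intro a ha
  rw [mem_knowledgeSet_iff] at ha ⊢
  obtain ⟨k, s, ha, hc⟩ := ha
  refine ⟨k, s, ?_, h.carries hij hc⟩
  have key : ∀ l, (l = j → ∃ s' ∈ ε.contactSet j i t, s ≤ s') →
      ε'.agentValue l s = ε.agentValue l s := by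
    intro l hl
    by_cases hlj : l = j
    · obtain ⟨v, hv, hv'⟩ := hl hlj
      subst hlj
      exact h.val_self s (le_trans (by exact_mod_cast hv') (le_lastContact hv))
    · exact h.val l hlj s
  have self : k = j → ∃ s' ∈ ε.contactSet j i t, s ≤ s' := by
    rintro rfl
    obtain ⟨v, hv, hv'⟩ := hc.exists_contact_self hij
    exact ⟨v, hv, hv'.le⟩
  cases ha with
  | init => rw [← key k self]; exact .init _
  | repl _ _ hr =>
    rw [← key k self]
    refine .repl _ _ ?_
    by_cases hkj : k = j
    · obtain ⟨v, hv, hv'⟩ := self hkj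
      subst hkj
      exact (h.repl_self s (le_trans (by exact_mod_cast hv') (le_lastContact hv))).2 hr
    · exact (h.repl k hkj s).2 hr
  | value l _ _ hx =>
    rw [← key l (by rintro rfl; exact hc.exists_contact hij hx)]
    exact .value _ _ _ (by rwa [ExchangeAt, ← h.exch])
  | exchange _ _ _ hx => exact .exchange _ _ _ (by rwa [ExchangeAt, ← h.exch])

theorem AgreeUntilContact.knowledgeSet_eq {ε ε' : Scenario N} {i j : Fin N} {t : ℝ}
    (hij : i ≠ j) (h : AgreeUntilContact ε ε' j i t) :
    ε'.knowledgeSet i t = ε.knowledgeSet i t :=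
  (h.symm.knowledgeSet_subset hij).antisymm (h.knowledgeSet_subset hij)

end Scenario

/-! ### Regular scenarios and the most recent information -/

namespace Scenario

variable {N : ℕ}

/-- The properties that almost every scenario has. -/
structure Regular (ε : Scenario N) : Prop where
  gap_pos : ∀ i n, 0 < ε.gap i n
  tendsto_replTime : ∀ i, Filter.Tendsto (ε.replTime i) Filter.atTop Filter.atTop
  exch_pos : ∀ j i n, 0 < ε.exch j i n
  exch_finite : ∀ j i, ∀ t : ℝ, {n | ε.exch j i n ≤ (t : EReal)}.Finite

/-- The time at which the `n`-th successive holder of the label `i` arrives. -/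
noncomputable def arrival (ε : Scenario N) (i : Fin N) (n : ℕ) : ℝ :=
  ∑ k ∈ Finset.range n, ε.gap i k

theorem arrival_succ (ε : Scenario N) (i : Fin N) (n : ℕ) :
    ε.arrival i (n + 1) = ε.arrival i n + ε.gap i n :=
  Finset.sum_range_succ _ _

theorem Regular.arrival_mono {ε : Scenario N} (h : ε.Regular) (i : Fin N) :
    Monotone (ε.arrival i) :=
  monotone_nat_of_le_succ fun n => by rw [arrival_succ]; linarith [h.gap_pos i n]

theorem Regular.replTime_le_iff {ε : Scenario N} (h : ε.Regular) {i : Fin N} {m n : ℕ} {s : ℝ}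
    (h1 : ε.arrival i m ≤ s) (h2 : s < ε.arrival i (m + 1)) : ε.replTime i n ≤ s ↔ n < m := by
  change ε.arrival i (n + 1) ≤ s ↔ _
  constructor
  · intro h3
    by_contra! h4
    linarith [h.arrival_mono i (Nat.succ_le_succ h4)]
  · intro h3
    exact (h.arrival_mono i h3).trans h1

theorem Regular.numRepl_eq {ε : Scenario N} (h : ε.Regular) {i : Fin N} {m : ℕ} {s : ℝ}
    (h1 : ε.arrival i m ≤ s) (h2 : s < ε.arrival i (m + 1)) : ε.numRepl i s = m := by
  have : {n | ε.replTime i n ≤ s} = (Finset.range m : Set ℕ) := by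
    ext n
    simp [h.replTime_le_iff h1 h2]
  rw [numRepl, this, Set.ncard_coe_finset, Finset.card_range]

theorem Regular.exists_arrival {ε : Scenario N} (h : ε.Regular) (i : Fin N) {s : ℝ} (hs : 0 ≤ s) :
    ∃ m, ε.arrival i m ≤ s ∧ s < ε.arrival i (m + 1) := by
  classical
  have hex : ∃ n, s < ε.arrival i (n + 1) :=
    ((h.tendsto_replTime i).eventually (Filter.eventually_gt_atTop s)).exists
  refine ⟨Nat.find hex, ?_, Nat.find_spec hex⟩
  rcases hm : Nat.find hex with _ | m
  · simpa [arrival] using hs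
  · have := Nat.find_min hex (m := m) (by omega)
    exact not_lt.1 this

theorem Regular.numRepl_eq_iff {ε : Scenario N} (h : ε.Regular) {i : Fin N} {m : ℕ} {s : ℝ}
    (hs : 0 ≤ s) : ε.numRepl i s = m ↔ ε.arrival i m ≤ s ∧ s < ε.arrival i (m + 1) := by
  constructor
  · rintro rfl
    obtain ⟨m, h1, h2⟩ := h.exists_arrival i hs
    rw [h.numRepl_eq h1 h2]
    exact ⟨h1, h2⟩
  · rintro ⟨h1, h2⟩
    exact h.numRepl_eq h1 h2

theorem Regular.finite_replTime_le {ε : Scenario N} (h : ε.Regular) (i : Fin N) (s : ℝ) :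
    {n | ε.replTime i n ≤ s}.Finite := by
  have := (h.tendsto_replTime i).eventually (Filter.eventually_gt_atTop s)
  rw [← Nat.cofinite_eq_atTop] at this
  simpa [Filter.eventually_cofinite] using this

theorem Regular.numRepl_mono {ε : Scenario N} (h : ε.Regular) {i : Fin N} {s s' : ℝ}
    (hs : s ≤ s') : ε.numRepl i s ≤ ε.numRepl i s' :=
  Set.ncard_le_ncard (fun _ hn => le_trans hn hs) (h.finite_replTime_le i s')

theorem agentValue_eq_of_not_replacedAt {ε : Scenario N} {i : Fin N} {s t : ℝ} (hst : s ≤ t)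
    (hk : ∀ u, s < u → u ≤ t → ¬ ε.ReplacedAt i u) : ε.agentValue i s = ε.agentValue i t := by
  have : {n | ε.replTime i n ≤ s} = {n | ε.replTime i n ≤ t} := by
    ext n
    refine ⟨fun h => le_trans h hst, fun h => ?_⟩
    by_contra h'
    exact hk _ (not_le.1 h') h ⟨n, rfl⟩
  rw [agentValue, agentValue, numRepl, numRepl, this]

theorem eq_agentValue_of_mem {ε : Scenario N} {i l : Fin N} {t x s : ℝ}
    (h : (Sum.inl (x, l, s) : Info N) ∈ ε.knowledgeSet i t) : x = ε.agentValue l s := by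
  obtain ⟨k, s', ha, -⟩ := mem_knowledgeSet_iff.1 h
  cases ha <;> rfl

/-- The times of the pieces of information about the value of agent `j` in `K`. -/
def infoTimes (j : Fin N) (K : Set (Info N)) : Set ℝ :=
  {s | ∃ x, (Sum.inl (x, j, s) : Info N) ∈ K}

theorem mem_infoTimes_iff {ε : Scenario N} {i j : Fin N} {t s : ℝ} :
    s ∈ infoTimes j (ε.knowledgeSet i t) ↔
      (Sum.inl (ε.agentValue j s, j, s) : Info N) ∈ ε.knowledgeSet i t := by
  refine ⟨fun ⟨x, hx⟩ => ?_, fun h => ⟨_, h⟩⟩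
  rwa [← eq_agentValue_of_mem hx]

theorem exists_of_mem_infoTimes {ε : Scenario N} {i j : Fin N} {t s : ℝ}
    (h : s ∈ infoTimes j (ε.knowledgeSet i t)) :
    (ε.Carries (fun _ => True) i t j s ∧ (s = 0 ∨ ε.ReplacedAt j s)) ∨
      ∃ k, ε.ExchangeAt j k s ∧ ε.Carries (fun _ => True) i t k s := by
  obtain ⟨x, hx⟩ := h
  obtain ⟨k, s', ha, hc⟩ := mem_knowledgeSet_iff.1 hx
  cases ha with
  | init => exact .inl ⟨hc, .inl rfl⟩
  | repl _ _ hr => exact .inl ⟨hc, .inr hr⟩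
  | value _ _ _ hx' => exact .inr ⟨k, hx', hc⟩

/-- Every such time is 0, a replacement of `j` or an exchange sent by `j`, and only finitely many of
these occur up to t. Hence latest times are attained. -/
theorem Regular.finite_infoTimes {ε : Scenario N} (h : ε.Regular) (i j : Fin N) (t : ℝ) :
    (infoTimes j (ε.knowledgeSet i t)).Finite := by
  refine Set.Finite.subset
    (((Set.finite_singleton (0 : ℝ)).union ((h.finite_replTime_le j t).image (ε.replTime j))).union
      (Set.finite_iUnion fun k => (h.exch_finite j k t).image fun n => (ε.exch j k n).toReal)) ?_
  intro s hs
  rcases exists_of_mem_infoTimes hs with ⟨hc, rfl | ⟨n, rfl⟩⟩ | ⟨k, ⟨n, hn⟩, hc⟩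
  · exact .inl (.inl rfl)
  · exact .inl (.inr ⟨n, hc.le, rfl⟩)
  · refine .inr (Set.mem_iUnion.2 ⟨k, n, ?_, by simp [hn]⟩)
    simpa [hn] using hc.le

theorem contactSet_subset {ε : Scenario N} {i j : Fin N} {t : ℝ} :
    ε.contactSet j i t ⊆ infoTimes j (ε.knowledgeSet i t) := by
  rintro s ⟨k, h, hc⟩
  exact ⟨_, hc.mem_knowledgeSet (.value j k s h)⟩

theorem exists_contact_of_mem_infoTimes {ε : Scenario N} {i j : Fin N} {t s : ℝ} (hij : i ≠ j)
    (h : s ∈ infoTimes j (ε.knowledgeSet i t)) : ∃ s' ∈ ε.contactSet j i t, s ≤ s' := by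
  rcases exists_of_mem_infoTimes h with ⟨hc, -⟩ | ⟨k, hx, hc⟩
  · obtain ⟨s', h1, h2⟩ := hc.exists_contact_self hij
    exact ⟨s', h1, h2.le⟩
  · exact hc.exists_contact hij hx

theorem Regular.pos_of_mem_contactSet {ε : Scenario N} (h : ε.Regular) {i j : Fin N} {t s : ℝ}
    (hs : s ∈ ε.contactSet j i t) : 0 < s := by
  obtain ⟨k, ⟨n, hn⟩, -⟩ := hs
  have := h.exch_pos j k n
  rw [hn] at this
  exact_mod_cast this

theorem le_of_mem_contactSet {ε : Scenario N} {i j : Fin N} {t s : ℝ}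
    (hs : s ∈ ε.contactSet j i t) : s ≤ t := by
  obtain ⟨k, -, hc⟩ := hs
  exact hc.le

theorem sSup_coe_eq_of_isGreatest {A : Set ℝ} {s : ℝ} (h : IsGreatest A s) :
    sSup ((fun s : ℝ => (s : EReal)) '' A) = s := by
  refine IsLUB.sSup_eq (IsGreatest.isLUB ⟨⟨s, h.1, rfl⟩, ?_⟩)
  rintro _ ⟨u, hu, rfl⟩
  exact EReal.coe_le_coe_iff.2 (h.2 hu)

theorem lastContact_eq_bot_iff {ε : Scenario N} {i j : Fin N} {t : ℝ} :
    ε.lastContact j i t = ⊥ ↔ ε.contactSet j i t = ∅ := by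
  rw [lastContact, sSup_eq_bot]
  constructor
  · intro h
    rw [Set.eq_empty_iff_forall_notMem]
    intro s hs
    exact EReal.coe_ne_bot s (h _ ⟨s, hs, rfl⟩)
  · intro h
    simp [h]

theorem Regular.exists_lastContact {ε : Scenario N} (h : ε.Regular) {i j : Fin N} {t : ℝ}
    (hij : i ≠ j) (hne : ε.lastContact j i t ≠ ⊥) :
    ∃ s : ℝ, ε.lastContact j i t = (s : EReal) ∧ 0 < s ∧ s ≤ t ∧
      IsGreatest (infoTimes j (ε.knowledgeSet i t)) s := by
  rw [Ne, lastContact_eq_bot_iff, ← Ne, ← Set.nonempty_iff_ne_empty] at hne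
  have hfin := (h.finite_infoTimes i j t).subset contactSet_subset
  obtain ⟨s, hs⟩ := hfin.exists_maximal hne
  have hg : IsGreatest (ε.contactSet j i t) s :=
    ⟨hs.1, fun u hu => (le_total u s).elim id fun h => hs.2 hu h⟩
  refine ⟨s, sSup_coe_eq_of_isGreatest hg, h.pos_of_mem_contactSet hg.1,
    le_of_mem_contactSet hg.1, contactSet_subset hg.1, fun u hu => ?_⟩
  obtain ⟨v, hv, huv⟩ := exists_contact_of_mem_infoTimes hij hu
  exact huv.trans (hg.2 hv)

theorem infoTimes_eq_empty {ε : Scenario N} {i j : Fin N} {t : ℝ}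
    (hij : i ≠ j) (h : ε.lastContact j i t = ⊥) :
    infoTimes j (ε.knowledgeSet i t) = ∅ := by
  rw [lastContact_eq_bot_iff] at h
  rw [Set.eq_empty_iff_forall_notMem]
  intro s hs
  obtain ⟨v, hv, -⟩ := exists_contact_of_mem_infoTimes hij hs
  simp [h] at hv

/-- The current holder stored its own value on arrival and nothing was erased since. Later
information about `i` may have come back through others, but it dates from the same tenure and shows
the same value. -/
theorem Regular.exists_isGreatest_infoTimes_self {ε : Scenario N} (h : ε.Regular) {i : Fin N}
    {t : ℝ} (ht : 0 ≤ t) :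
    ∃ s, IsGreatest (infoTimes i (ε.knowledgeSet i t)) s ∧
      ε.agentValue i s = ε.agentValue i t := by
  obtain ⟨m, h1, h2⟩ := h.exists_arrival i ht
  have hk : ∀ u, ε.arrival i m < u → u ≤ t → ¬ ε.ReplacedAt i u := by
    rintro u hu hut ⟨n, rfl⟩
    rw [h.replTime_le_iff h1 h2] at hut
    exact absurd (h.arrival_mono i (Nat.succ_le_of_lt hut)) (not_le.2 hu)
  have hmem : ε.arrival i m ∈ infoTimes i (ε.knowledgeSet i t) := by
    rw [mem_infoTimes_iff]
    refine ⟨ε.arrival i m, h1, ?_, hk⟩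
    rcases m with _ | m
    · have : ε.arrival i 0 = 0 := by simp [arrival]
      rw [this]
      exact .init i
    · exact .repl _ _ ⟨m, rfl⟩
  obtain ⟨s, hs⟩ := (h.finite_infoTimes i i t).exists_maximal ⟨_, hmem⟩
  have hg : IsGreatest (infoTimes i (ε.knowledgeSet i t)) s :=
    ⟨hs.1, fun u hu => (le_total u s).elim id fun h => hs.2 hu h⟩
  refine ⟨s, hg, agentValue_eq_of_not_replacedAt ?_ fun u hu hut =>
    hk u ((hg.2 hmem).trans_lt hu) hut⟩
  rcases exists_of_mem_infoTimes hg.1 with ⟨hc, -⟩ | ⟨k, hx, hc⟩ <;> exact hc.le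

/-- The time of the most recent information about agent `j` in `K`. -/
noncomputable def recentTime (j : Fin N) (K : Set (Info N)) : EReal :=
  sSup ((fun s : ℝ => (s : EReal)) '' infoTimes j K)

/-- The sets in which the most recent values of agent `j` are larger than `c`. -/
def recentAbove (j : Fin N) (c : ℝ) : Set (Set (Info N)) :=
  {K | ∃ q : ℚ, (K ∩ Sum.inl '' (Set.Ioi c ×ˢ {j} ×ˢ Set.Ioi (q : ℝ))).Nonempty ∧
    ¬ (K ∩ Sum.inl '' (Set.Iic c ×ˢ {j} ×ˢ Set.Ioi (q : ℝ))).Nonempty}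

open Classical in
/-- The most recent value of agent `j` in `K`. -/
noncomputable def recentValue (j : Fin N) (K : Set (Info N)) : EReal :=
  ⨆ c : ℚ, if K ∈ recentAbove j c then ((c : ℝ) : EReal) else ⊥

/-- As the information times are finite in number, some rational separates the latest from all
earlier ones. Beyond it only the latest value is seen, so comparing this value with c amounts to one
hit and one miss. -/
theorem Regular.mem_recentAbove_iff {ε : Scenario N} (h : ε.Regular) {i j : Fin N} {t s c : ℝ}
    (hs : IsGreatest (infoTimes j (ε.knowledgeSet i t)) s) :
    ε.knowledgeSet i t ∈ recentAbove j c ↔ c < ε.agentValue j s := by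
  have hitem := mem_infoTimes_iff.1 hs.1
  constructor
  · rintro ⟨q, ⟨_, h1, ⟨⟨x, j', u⟩, ⟨hx, rfl, hu⟩, rfl⟩⟩, h2⟩
    by_contra! hle
    have : u ≤ s := hs.2 ⟨x, h1⟩
    exact h2 ⟨_, hitem, ⟨(ε.agentValue j' s, j', s), ⟨hle, rfl, lt_of_lt_of_le hu this⟩, rfl⟩⟩
  · intro hc
    have hfin := (h.finite_infoTimes i j t).subset (Set.sep_subset _ fun u => u < s)
    obtain ⟨q, hq1, hq2⟩ : ∃ q : ℚ, (q : ℝ) < s ∧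
        ∀ u ∈ infoTimes j (ε.knowledgeSet i t), u < s → u ≤ q := by
      rcases Set.eq_empty_or_nonempty {u ∈ infoTimes j (ε.knowledgeSet i t) | u < s} with he | hne
      · obtain ⟨q, hq⟩ := exists_rat_lt s
        refine ⟨q, hq, fun u hu hus => ?_⟩
        have : u ∈ {u ∈ infoTimes j (ε.knowledgeSet i t) | u < s} := ⟨hu, hus⟩
        simp [he] at this
      · obtain ⟨v, hv⟩ := hfin.exists_maximal hne
        obtain ⟨q, hq1, hq2⟩ := exists_rat_btwn hv.1.2
        exact ⟨q, hq2, fun u hu hus =>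
          ((le_total u v).elim id fun h => hv.2 ⟨hu, hus⟩ h).trans hq1.le⟩
    refine ⟨q, ⟨_, hitem, ⟨(ε.agentValue j s, j, s), ⟨hc, rfl, hq1⟩, rfl⟩⟩, ?_⟩
    rintro ⟨_, h1, ⟨⟨x, j', u⟩, ⟨hx, rfl, hu⟩, rfl⟩⟩
    have hus : u = s := (hs.2 ⟨x, h1⟩).antisymm
      (not_lt.1 fun hlt => absurd (hq2 u ⟨x, h1⟩ hlt) (not_le.2 hu))
    subst hus
    have hxe := eq_agentValue_of_mem h1
    simp only [Set.mem_Iic] at hx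
    linarith

theorem Regular.recentValue_eq {ε : Scenario N} (h : ε.Regular) {i j : Fin N} {t s : ℝ}
    (hs : IsGreatest (infoTimes j (ε.knowledgeSet i t)) s) :
    recentValue j (ε.knowledgeSet i t) = ε.agentValue j s := by
  simp only [recentValue, h.mem_recentAbove_iff hs]
  refine le_antisymm (iSup_le fun c => ?_) (le_of_forall_lt fun b hb => ?_)
  · split_ifs with hc
    · exact_mod_cast hc.le
    · exact bot_le
  · obtain ⟨c, hc1, hc2⟩ := EReal.exists_rat_btwn_of_lt hb
    have hc2' : (c : ℝ) < ε.agentValue j s := by exact_mod_cast hc2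
    refine lt_of_lt_of_le hc1 (le_iSup_of_le c ?_)
    rw [if_pos hc2']

theorem recentTime_eq {ε : Scenario N} {i j : Fin N} {t s : ℝ}
    (hs : IsGreatest (infoTimes j (ε.knowledgeSet i t)) s) :
    recentTime j (ε.knowledgeSet i t) = s :=
  sSup_coe_eq_of_isGreatest hs

theorem Regular.recentTime_eq_lastContact {ε : Scenario N} (h : ε.Regular) {i j : Fin N} {t : ℝ}
    (hij : i ≠ j) : recentTime j (ε.knowledgeSet i t) = ε.lastContact j i t := by
  by_cases hb : ε.lastContact j i t = ⊥
  · rw [hb, recentTime, infoTimes_eq_empty hij hb]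
    simp
  · obtain ⟨s, h1, -, -, h2⟩ := h.exists_lastContact hij hb
    rw [h1, recentTime_eq h2]

theorem Regular.age_le_iff {ε : Scenario N} (h : ε.Regular) {i j : Fin N} {t s : ℝ}
    (hij : i ≠ j) : ε.age j i t ≤ (s : EReal) ↔
      ε.lastContact j i t ≠ ⊥ ∧ t - (ε.lastContact j i t).toReal ≤ s := by
  have hset : {s | (Sum.inl (ε.agentValue j (t - s), j, t - s) : Info N) ∈ ε.knowledgeSet i t} =
      {s | t - s ∈ infoTimes j (ε.knowledgeSet i t)} := by
    ext s
    exact mem_infoTimes_iff.symm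
  rw [age, hset]
  by_cases hb : ε.lastContact j i t = ⊥
  · simp [infoTimes_eq_empty hij hb, hb]
  · obtain ⟨v, h1, -, -, h2⟩ := h.exists_lastContact hij hb
    have : sInf ((fun s : ℝ => (s : EReal)) '' {s | t - s ∈ infoTimes j (ε.knowledgeSet i t)}) =
        ((t - v : ℝ) : EReal) := by
      refine IsGLB.sInf_eq (IsLeast.isGLB ⟨⟨t - v, ?_, rfl⟩, ?_⟩)
      · simpa using h2.1
      · rintro _ ⟨u, hu, rfl⟩
        have := h2.2 hu
        simp only [EReal.coe_le_coe_iff]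
        linarith
    rw [this, h1]
    simp only [EReal.coe_le_coe_iff, EReal.toReal_coe, ne_eq, EReal.coe_ne_bot, not_false_eq_true,
      true_and]

/-! ### Changing one value or one waiting time of `j` -/

/-- The scenario in which the `m`-th value attributed to `j` is replaced by `c`. -/
def setValue (ε : Scenario N) (j : Fin N) (m : ℕ) (c : ℝ) : Scenario N where
  value := Function.update ε.value j (Function.update (ε.value j) m c)
  gap := ε.gap
  exch := ε.exch

/-- The scenario in which the `m`-th waiting time of `j` is replaced by `c`. -/
def setGap (ε : Scenario N) (j : Fin N) (m : ℕ) (c : ℝ) : Scenario N where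
  value := ε.value
  gap := Function.update ε.gap j (Function.update (ε.gap j) m c)
  exch := ε.exch

theorem knowledgeSet_setValue {ε : Scenario N} {i j : Fin N} {t : ℝ} (hij : i ≠ j) {m : ℕ} {c : ℝ}
    (h : ∀ u : ℝ, (u : EReal) ≤ ε.lastContact j i t → ε.numRepl j u ≠ m) :
    (ε.setValue j m c).knowledgeSet i t = ε.knowledgeSet i t := by
  refine AgreeUntilContact.knowledgeSet_eq hij (j := j)
    ⟨rfl, fun k hk u => Iff.rfl, fun k hk u => ?_, fun u hu => Iff.rfl, fun u hu => ?_⟩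
  · change Function.update ε.value j _ k (ε.numRepl k u) = _
    rw [Function.update_of_ne hk]
    rfl
  · change Function.update ε.value j _ j (ε.numRepl j u) = _
    rw [Function.update_self, Function.update_of_ne (h u hu)]
    rfl

theorem replTime_setGap_of_ne {ε : Scenario N} {j k : Fin N} (hk : k ≠ j) (m n : ℕ) (c : ℝ) :
    (ε.setGap j m c).replTime k n = ε.replTime k n := by
  simp [replTime, setGap, Function.update_of_ne hk]

theorem arrival_setGap {ε : Scenario N} {j : Fin N} {m n : ℕ} (hn : n ≤ m) (c : ℝ) :
    (ε.setGap j m c).arrival j n = ε.arrival j n := by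
  refine Finset.sum_congr rfl fun k hk => ?_
  have : k ≠ m := by have := Finset.mem_range.1 hk; omega
  simp [setGap, Function.update_of_ne this]

theorem lastContact_setGap {ε : Scenario N} {i j : Fin N} {t c : ℝ} {m : ℕ} :
    (ε.setGap j m c).lastContact j i t = ε.lastContact j i t := by
  have : (ε.setGap j m c).contactSet j i t = ε.contactSet j i t :=
    contactSet_congr rfl fun k hk u => by simp [ReplacedAt, replTime_setGap_of_ne hk]
  rw [lastContact, this, lastContact]

/-- If holder m is present at the last contact, its waiting time only determines replacements of `j`
after that contact. A waiting time above t keeps them after it. -/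
theorem Regular.knowledgeSet_setGap {ε : Scenario N} (h : ε.Regular) {i j : Fin N} {t c : ℝ}
    (hij : i ≠ j) (htc : t < c) (hne : ε.lastContact j i t ≠ ⊥) {m : ℕ}
    (hm : ε.numRepl j (ε.lastContact j i t).toReal = m) :
    (ε.setGap j m c).knowledgeSet i t = ε.knowledgeSet i t := by
  obtain ⟨v, h1, h2, h3, -⟩ := h.exists_lastContact hij hne
  rw [h1, EReal.toReal_coe, h.numRepl_eq_iff h2.le] at hm
  have key : ∀ n, (n < m ∧ (ε.setGap j m c).replTime j n = ε.replTime j n) ∨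
      (v < (ε.setGap j m c).replTime j n ∧ v < ε.replTime j n) := by
    intro n
    rcases lt_or_ge n m with hn | hn
    · exact .inl ⟨hn, arrival_setGap (Nat.succ_le_of_lt hn) c⟩
    · refine .inr ⟨?_, hm.2.trans_le (h.arrival_mono j (Nat.succ_le_succ hn))⟩
      -- For n ≥ m the new replacement time is a sum of nonnegative gaps, one of which is c.
      have hle := Finset.single_le_sum (f := (ε.setGap j m c).gap j) (s := Finset.range (n + 1))
        (fun k _ => by
          by_cases hk : k = m
          · simp only [setGap, Function.update_self, hk]
            linarith
          · simp [setGap, Function.update_of_ne hk, (h.gap_pos j k).le])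
        (Finset.mem_range.2 (Nat.lt_succ_of_le hn))
      have hgap : (ε.setGap j m c).gap j m = c := by simp [setGap]
      rw [hgap] at hle
      exact lt_of_le_of_lt h3 (htc.trans_le hle)
  have hother : ∀ k, k ≠ j → ∀ u, (ε.setGap j m c).agentValue k u = ε.agentValue k u := by
    intro k hk u
    simp only [agentValue, numRepl, replTime_setGap_of_ne hk]
    rfl
  refine AgreeUntilContact.knowledgeSet_eq hij (j := j)
    ⟨rfl, fun k hk u => by simp [ReplacedAt, replTime_setGap_of_ne hk], hother,
      fun u hu => ?_, fun u hu => ?_⟩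
  · rw [h1] at hu
    have hu : u ≤ v := by exact_mod_cast hu
    refine exists_congr fun n => ?_
    rcases key n with ⟨-, hn⟩ | ⟨ha, hb⟩
    · rw [hn]
    · exact ⟨fun e => by linarith, fun e => by linarith⟩
  · rw [h1] at hu
    have hu : u ≤ v := by exact_mod_cast hu
    have : {n | (ε.setGap j m c).replTime j n ≤ u} = {n | ε.replTime j n ≤ u} := by
      ext n
      rcases key n with ⟨-, hn⟩ | ⟨ha, hb⟩
      · simp [hn]
      · exact ⟨fun e => absurd e (not_le.2 (hu.trans_lt ha)),
          fun e => absurd e (not_le.2 (hu.trans_lt hb))⟩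
    simp only [agentValue, numRepl, this]
    rfl

end Scenario

/-! ### Measurability -/

namespace Scenario

variable {N : ℕ}

noncomputable instance : MeasurableSpace (Scenario N) :=
  MeasurableSpace.comap (fun ε => (ε.value, ε.exch, ε.gap)) inferInstance

theorem measurable_components :
    Measurable fun ε : Scenario N => (ε.value, ε.exch, ε.gap) :=
  comap_measurable _

theorem measurable_of_components {α : Type*} [MeasurableSpace α] {f : α → Scenario N}
    (hv : Measurable fun a => (f a).value) (he : Measurable fun a => (f a).exch)
    (hg : Measurable fun a => (f a).gap) : Measurable f :=
  measurable_comap_iff.2 (hv.prodMk (he.prodMk hg))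

@[fun_prop]
theorem measurable_value : Measurable (Scenario.value : Scenario N → _) :=
  measurable_components.fst

@[fun_prop]
theorem measurable_exch : Measurable (Scenario.exch : Scenario N → _) :=
  measurable_components.snd.fst

@[fun_prop]
theorem measurable_gap : Measurable (Scenario.gap : Scenario N → _) :=
  measurable_components.snd.snd

theorem measurable_value_apply (i : Fin N) (n : ℕ) :
    Measurable fun ε : Scenario N => ε.value i n := by
  fun_prop

theorem measurable_gap_apply (i : Fin N) (n : ℕ) :
    Measurable fun ε : Scenario N => ε.gap i n := by
  fun_prop

theorem measurable_exch_apply (j i : Fin N) (n : ℕ) :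
    Measurable fun ε : Scenario N => ε.exch j i n := by
  fun_prop

theorem measurable_replTime (i : Fin N) (n : ℕ) :
    Measurable fun ε : Scenario N => ε.replTime i n :=
  Finset.measurable_sum _ fun k _ => measurable_gap_apply i k

theorem measurable_arrival (i : Fin N) (n : ℕ) :
    Measurable fun ε : Scenario N => ε.arrival i n :=
  Finset.measurable_sum _ fun k _ => measurable_gap_apply i k

theorem measurable_numRepl (i : Fin N) :
    Measurable fun q : Scenario N × ℝ => q.1.numRepl i q.2 := by
  classical
  -- The junk values agree: for an infinite set `ncard` is 0, and so is the real part of an infinite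
  -- sum.
  have h : (fun q : Scenario N × ℝ => q.1.numRepl i q.2) = fun q : Scenario N × ℝ =>
      ⌊(∑' n, if q.1.replTime i n ≤ q.2 then (1 : ENNReal) else 0).toReal⌋₊ := by
    ext q
    have h1 : (∑' n, if q.1.replTime i n ≤ q.2 then (1 : ENNReal) else 0) =
        ({n | q.1.replTime i n ≤ q.2}.encard : ENNReal) := by
      rw [← ENNReal.tsum_set_one, tsum_subtype {n | q.1.replTime i n ≤ q.2} fun _ => (1 : ENNReal)]
      rfl
    rw [h1, numRepl, Set.ncard]
    generalize Set.encard _ = e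
    cases e <;> simp
  rw [h]
  refine Nat.measurable_floor.comp (Measurable.ennreal_toReal (Measurable.tsum fun n => ?_))
  exact Measurable.ite (measurableSet_le ((measurable_replTime i n).comp measurable_fst)
    measurable_snd) measurable_const measurable_const

theorem measurable_agentValue (i : Fin N) :
    Measurable fun q : Scenario N × ℝ => q.1.agentValue i q.2 := by
  have h : Measurable fun p : Scenario N × ℕ => p.1.value i p.2 :=
    measurable_from_prod_countable_left fun n => measurable_value_apply i n
  exact h.comp (measurable_fst.prodMk (measurable_numRepl i))

/-- The pairs `(ε, s)` such that what enters the knowledge set of agent `k` at time `s` is passed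
on to agent `i` at time `t` by `n` exchanges. -/
def carriesIn (p : Fin N → Prop) (i : Fin N) (t : ℝ) : ℕ → Fin N → Scenario N × ℝ → Prop
  | 0, k, q => p k ∧ k = i ∧ q.2 ≤ t ∧ ∀ n, q.2 < q.1.replTime i n → ¬ q.1.replTime i n ≤ t
  | n + 1, k, q => p k ∧ ∃ k' m, (q.1.exch k k' m ≠ ⊤ ∧ q.1.exch k k' m ≠ ⊥) ∧
      q.2 < (q.1.exch k k' m).toReal ∧
      (∀ l, q.2 < q.1.replTime k l → ¬ q.1.replTime k l < (q.1.exch k k' m).toReal) ∧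
      carriesIn p i t n k' (q.1, (q.1.exch k k' m).toReal)

theorem exists_carriesIn_iff {p : Fin N → Prop} {i k : Fin N} {t s : ℝ} {ε : Scenario N} :
    ε.Carries p i t k s ↔ ∃ n, carriesIn p i t n k (ε, s) := by
  constructor
  · intro h
    induction h with
    | stay s hp hs hk => exact ⟨0, hp, rfl, hs, fun n h1 h2 => hk _ h1 h2 ⟨n, rfl⟩⟩
    | send k k' s s' hp h hs hk hc ih =>
      obtain ⟨n, hn⟩ := ih
      obtain ⟨m, hm⟩ := h
      refine ⟨n + 1, hp, k', m, by simp [hm], ?_⟩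
      simp only [hm, EReal.toReal_coe]
      exact ⟨hs, fun l h1 h2 => hk _ h1 h2 ⟨l, rfl⟩, hn⟩
  · rintro ⟨n, hn⟩
    induction n generalizing k s with
    | zero =>
      obtain ⟨hp, rfl, hs, hk⟩ := hn
      exact .stay s hp hs fun u h1 h2 ⟨l, hl⟩ => hk l (hl ▸ h1) (hl ▸ h2)
    | succ n ih =>
      obtain ⟨hp, k', m, ⟨h1, h2⟩, hs, hk, hc⟩ := hn
      exact .send k k' s _ hp ⟨m, (EReal.coe_toReal h1 h2).symm⟩ hs
        (fun u h1 h2 ⟨l, hl⟩ => hk l (hl ▸ h1) (hl ▸ h2)) (ih hc)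

theorem measurable_carriesIn (p : Fin N → Prop) (i : Fin N) (t : ℝ) (n : ℕ) (k : Fin N) :
    Measurable (carriesIn p i t n k) := by
  have hr : ∀ k n, Measurable fun q : Scenario N × ℝ => q.1.replTime k n :=
    fun k n => (measurable_replTime k n).comp measurable_fst
  have he : ∀ k k' n, Measurable fun q : Scenario N × ℝ => q.1.exch k k' n :=
    fun k k' n => (measurable_exch_apply k k' n).comp measurable_fst
  induction n generalizing k with
  | zero =>
    refine measurable_const.and (measurable_const.and (Measurable.and ?_ (.forall fun n =>
      Measurable.imp ?_ (Measurable.not ?_))))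
    · exact measurableSet_setOfPred.1 (measurableSet_le measurable_snd measurable_const)
    · exact measurableSet_setOfPred.1 (measurableSet_lt measurable_snd (hr i n))
    · exact measurableSet_setOfPred.1 (measurableSet_le (hr i n) measurable_const)
  | succ n ih =>
    refine measurable_const.and (.exists fun k' => .exists fun m => Measurable.and
      (Measurable.and ?_ ?_) (Measurable.and ?_ (Measurable.and (.forall fun l =>
      Measurable.imp ?_ (Measurable.not ?_)) ?_)))
    · exact Measurable.not (measurableSet_setOfPred.1 ((he k k' m) (measurableSet_singleton _)))
    · exact Measurable.not (measurableSet_setOfPred.1 ((he k k' m) (measurableSet_singleton _)))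
    · exact measurableSet_setOfPred.1 (measurableSet_lt measurable_snd (he k k' m).ereal_toReal)
    · exact measurableSet_setOfPred.1 (measurableSet_lt measurable_snd (hr k l))
    · exact measurableSet_setOfPred.1 (measurableSet_lt (hr k l) (he k k' m).ereal_toReal)
    · exact (ih k').comp (measurable_fst.prodMk (he k k' m).ereal_toReal)

/-- Sorting chains by their number of exchanges, and indexing replacements and exchanges by natural
numbers rather than by real times, leaves only countable quantifiers. -/
theorem measurable_carries (p : Fin N → Prop) (i : Fin N) (t : ℝ) (k : Fin N) :
    Measurable fun q : Scenario N × ℝ => q.1.Carries p i t k q.2 := by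
  simp only [exists_carriesIn_iff]
  exact .exists fun n => measurable_carriesIn p i t n k

theorem exchangeAt_iff {ε : Scenario N} {j i : Fin N} {s : ℝ} :
    ε.ExchangeAt j i s ↔ ∃ n, (ε.exch j i n ≠ ⊤ ∧ ε.exch j i n ≠ ⊥) ∧
      (ε.exch j i n).toReal = s := by
  refine exists_congr fun n => ⟨fun h => by simp [h], ?_⟩
  rintro ⟨⟨h1, h2⟩, rfl⟩
  exact (EReal.coe_toReal h1 h2).symm

theorem measurable_exch_real (j i : Fin N) (n : ℕ) :
    Measurable fun ε : Scenario N => ε.exch j i n ≠ ⊤ ∧ ε.exch j i n ≠ ⊥ :=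
  (Measurable.not (measurableSet_setOfPred.1 ((measurable_exch_apply j i n)
    (measurableSet_singleton _)))).and
    (Measurable.not (measurableSet_setOfPred.1 ((measurable_exch_apply j i n)
      (measurableSet_singleton _))))

theorem measurable_lastContact (j i : Fin N) (t : ℝ) :
    Measurable fun ε : Scenario N => ε.lastContact j i t := by
  refine measurable_of_Ioi fun c => ?_
  have : (fun ε : Scenario N => ε.lastContact j i t) ⁻¹' Set.Ioi c = {ε | ∃ k n,
      (ε.exch j k n ≠ ⊤ ∧ ε.exch j k n ≠ ⊥) ∧ c < ε.exch j k n ∧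
        ε.Carries (· ≠ j) i t k (ε.exch j k n).toReal} := by
    ext ε
    simp only [Set.mem_preimage, Set.mem_Ioi, lastContact, lt_sSup_iff, Set.mem_ofPred_eq]
    constructor
    · rintro ⟨_, ⟨s, ⟨k, ⟨n, hn⟩, hc⟩, rfl⟩, hs⟩
      exact ⟨k, n, by simp [hn], by simpa [hn] using hs, by simpa [hn] using hc⟩
    · rintro ⟨k, n, ⟨h1, h2⟩, h3, h4⟩
      refine ⟨_, ⟨_, ⟨k, ⟨n, (EReal.coe_toReal h1 h2).symm⟩, h4⟩, rfl⟩, ?_⟩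
      simpa only [EReal.coe_toReal h1 h2] using h3
  rw [this]
  refine measurableSet_setOfPred.2 (.exists fun k => .exists fun n => (measurable_exch_real j k n).and
    (Measurable.and ?_ ?_))
  · exact measurableSet_setOfPred.1 (measurableSet_lt measurable_const (measurable_exch_apply j k n))
  · exact (measurable_carries (· ≠ j) i t k).comp
      (measurable_id.prodMk (measurable_exch_apply j k n).ereal_toReal)

/-- Every item originates at time 0, at a replacement or at an exchange. These form a countable
measurable family, so hitting B is a countable union of events. -/
theorem measurable_knowledgeSet (i : Fin N) (t : ℝ) :
    Measurable[_, hitMeasurableSpace N] fun ε : Scenario N => ε.knowledgeSet i t := by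
  refine measurable_generateFrom ?_
  rintro _ ⟨B, hB, rfl⟩
  have hset : (fun ε : Scenario N => ε.knowledgeSet i t) ⁻¹' {K | (K ∩ B).Nonempty} =
      {ε : Scenario N |
        (∃ k, ε.Carries (fun _ => True) i t k 0 ∧ Sum.inl (ε.agentValue k 0, k, 0) ∈ B) ∨
        (∃ k n, ε.Carries (fun _ => True) i t k (ε.replTime k n) ∧
          Sum.inl (ε.agentValue k (ε.replTime k n), k, ε.replTime k n) ∈ B) ∨
        (∃ j k n, (ε.exch j k n ≠ ⊤ ∧ ε.exch j k n ≠ ⊥) ∧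
          ε.Carries (fun _ => True) i t k (ε.exch j k n).toReal ∧
          Sum.inl (ε.agentValue j (ε.exch j k n).toReal, j, (ε.exch j k n).toReal) ∈ B) ∨
        (∃ j k n, (ε.exch j k n ≠ ⊤ ∧ ε.exch j k n ≠ ⊥) ∧
          ε.Carries (fun _ => True) i t k (ε.exch j k n).toReal ∧
          Sum.inr (j, k, (ε.exch j k n).toReal) ∈ B)} := by
    ext ε
    constructor
    · rintro ⟨a, ha, haB⟩
      obtain ⟨k, s, ha, hc⟩ := mem_knowledgeSet_iff.1 ha
      cases ha with
      | init => exact .inl ⟨k, hc, haB⟩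
      | repl _ _ h =>
        obtain ⟨n, rfl⟩ := h
        exact .inr (.inl ⟨k, n, hc, haB⟩)
      | value j _ _ h =>
        obtain ⟨n, hn, rfl⟩ := exchangeAt_iff.1 h
        exact .inr (.inr (.inl ⟨j, k, n, hn, hc, haB⟩))
      | exchange j _ _ h =>
        obtain ⟨n, hn, rfl⟩ := exchangeAt_iff.1 h
        exact .inr (.inr (.inr ⟨j, k, n, hn, hc, haB⟩))
    · rintro (⟨k, hc, hB⟩ | ⟨k, n, hc, hB⟩ | ⟨j, k, n, hn, hc, hB⟩ | ⟨j, k, n, hn, hc, hB⟩)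
      · exact ⟨_, mem_knowledgeSet_iff.2 ⟨_, _, .init k, hc⟩, hB⟩
      · exact ⟨_, mem_knowledgeSet_iff.2 ⟨_, _, .repl k _ ⟨n, rfl⟩, hc⟩, hB⟩
      · exact ⟨_, mem_knowledgeSet_iff.2
          ⟨_, _, .value j k _ (exchangeAt_iff.2 ⟨n, hn, rfl⟩), hc⟩, hB⟩
      · exact ⟨_, mem_knowledgeSet_iff.2
          ⟨_, _, .exchange j k _ (exchangeAt_iff.2 ⟨n, hn, rfl⟩), hc⟩, hB⟩
  have hcar : ∀ (k : Fin N) {f : Scenario N → ℝ}, Measurable f →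
      Measurable fun ε : Scenario N => ε.Carries (fun _ => True) i t k (f ε) :=
    fun k f hf => (measurable_carries (fun _ => True) i t k).comp (measurable_id.prodMk hf)
  have hval : ∀ (k : Fin N) {f : Scenario N → ℝ}, Measurable f → Measurable fun ε : Scenario N =>
      (Sum.inl (ε.agentValue k (f ε), k, f ε) : Info N) ∈ B := by
    intro k f hf
    refine measurableSet_setOfPred.1 (MeasurableSet.preimage hB (measurable_inl.comp ?_))
    exact ((measurable_agentValue k).comp (measurable_id.prodMk hf)).prodMk
      (measurable_const.prodMk hf)
  have hx : ∀ j k n, Measurable fun ε : Scenario N => (ε.exch j k n).toReal :=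
    fun j k n => (measurable_exch_apply j k n).ereal_toReal
  rw [hset]
  refine measurableSet_setOfPred.2 (Measurable.or ?_ (Measurable.or ?_ (Measurable.or ?_ ?_)))
  · exact .exists fun k => (hcar k measurable_const).and (hval k measurable_const)
  · exact .exists fun k => .exists fun n =>
      (hcar k (measurable_replTime k n)).and (hval k (measurable_replTime k n))
  · exact .exists fun j => .exists fun k => .exists fun n =>
      (measurable_exch_real j k n).and ((hcar k (hx j k n)).and (hval j (hx j k n)))
  · refine .exists fun j => .exists fun k => .exists fun n =>
      (measurable_exch_real j k n).and ((hcar k (hx j k n)).and ?_)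
    exact measurableSet_setOfPred.1 (MeasurableSet.preimage hB (measurable_inr.comp
      (measurable_const.prodMk (measurable_const.prodMk (hx j k n)))))

theorem measurableSet_hit {B : Set (Info N)} (hB : MeasurableSet B) :
    MeasurableSet[hitMeasurableSpace N] {K : Set (Info N) | (K ∩ B).Nonempty} :=
  MeasurableSpace.measurableSet_generateFrom ⟨B, hB, rfl⟩

theorem measurable_recentTime (j : Fin N) :
    Measurable[hitMeasurableSpace N] (recentTime j : Set (Info N) → EReal) := by
  let : MeasurableSpace (Set (Info N)) := hitMeasurableSpace N
  refine measurable_of_Ioi fun c => ?_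
  have : (recentTime j : Set (Info N) → EReal) ⁻¹' Set.Ioi c = {K | (K ∩ Sum.inl ''
      (Set.univ ×ˢ {j} ×ˢ ((fun s : ℝ => (s : EReal)) ⁻¹' Set.Ioi c))).Nonempty} := by
    ext K
    simp only [Set.mem_preimage, Set.mem_Ioi, recentTime, lt_sSup_iff, Set.mem_ofPred_eq]
    constructor
    · rintro ⟨_, ⟨s, ⟨x, hx⟩, rfl⟩, hs⟩
      exact ⟨_, hx, (x, j, s), ⟨trivial, rfl, hs⟩, rfl⟩
    · rintro ⟨_, hK, ⟨x, j', s⟩, ⟨-, rfl, hs⟩, rfl⟩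
      exact ⟨_, ⟨s, ⟨x, hK⟩, rfl⟩, hs⟩
  rw [this]
  exact measurableSet_hit (MeasurableSet.inl_image (MeasurableSet.univ.prod
    ((measurableSet_singleton _).prod (measurable_coe_real_ereal measurableSet_Ioi))))

theorem measurable_recentValue (j : Fin N) :
    Measurable[hitMeasurableSpace N] (recentValue j : Set (Info N) → EReal) := by
  let : MeasurableSpace (Set (Info N)) := hitMeasurableSpace N
  refine Measurable.iSup fun c => Measurable.ite ?_ measurable_const measurable_const
  refine measurableSet_setOfPred.2 (.exists fun q => Measurable.and ?_ (Measurable.not ?_))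
  · exact measurableSet_setOfPred.1 (measurableSet_hit (MeasurableSet.inl_image
      (measurableSet_Ioi.prod ((measurableSet_singleton _).prod measurableSet_Ioi))))
  · exact measurableSet_setOfPred.1 (measurableSet_hit (MeasurableSet.inl_image
      (measurableSet_Iic.prod ((measurableSet_singleton _).prod measurableSet_Ioi))))

theorem measurable_setValue (j : Fin N) (m : ℕ) (c : ℝ) :
    Measurable fun ε : Scenario N => ε.setValue j m c := by
  refine measurable_of_components ?_ measurable_exch measurable_gap
  refine measurable_pi_lambda _ fun k => measurable_pi_lambda _ fun n => ?_
  by_cases hk : k = j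
  · subst hk
    by_cases hn : n = m
    · subst hn; simp [setValue]
    · simpa [setValue, Function.update_of_ne hn] using measurable_value_apply k n
  · simpa [setValue, Function.update_of_ne hk] using measurable_value_apply k n

end Scenario

/-! ### Independence and exponential waiting times -/

section Independence

variable {Ω : Type*} {mΩ : MeasurableSpace Ω} {P : Measure Ω}

theorem ProbabilityTheory.iIndepFun.indepFun_compl {ι α : Type*} [MeasurableSpace α]
    {X : ι → Ω → α} (h : iIndepFun X P) (hX : ∀ q, Measurable (X q)) (p : ι) :
    IndepFun (X p) (fun ω (q : {q // q ≠ p}) => X q ω) P := by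
  have h1 := indep_iSup_of_disjoint (fun q => (hX q).comap_le) h
    (Set.disjoint_singleton_left.2 (fun h => h rfl : p ∉ {q | q ≠ p}))
  rw [IndepFun_iff_Indep]
  refine indep_of_indep_of_le_left (indep_of_indep_of_le_right h1 ?_) ?_
  · rw [← measurable_iff_comap_le]
    refine @measurable_pi_lambda _ _ _ (_) _ _ fun q => ?_
    rw [measurable_iff_comap_le]
    exact le_iSup₂_of_le q.1 q.2 le_rfl
  · exact le_iSup₂_of_le p rfl le_rfl

variable [IsProbabilityMeasure P]

/-- The joint law is a product of three measures, and products can be re-associated. -/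
theorem ProbabilityTheory.IndepFun.prodMk_right_of_prodMk_left {α β γ : Type*}
    [MeasurableSpace α] [MeasurableSpace β] [MeasurableSpace γ] {X : Ω → α} {Y : Ω → β} {Z : Ω → γ}
    (hX : Measurable X) (hY : Measurable Y) (hZ : Measurable Z) (hXY : IndepFun X Y P)
    (h : IndepFun (fun ω => (X ω, Y ω)) Z P) : IndepFun X (fun ω => (Y ω, Z ω)) P := by
  have hYZ : IndepFun Y Z P := h.comp measurable_snd measurable_id
  rw [indepFun_iff_map_prod_eq_prod_map_map (by fun_prop) (by fun_prop)] at hXY hYZ h ⊢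
  have := Measure.isProbabilityMeasure_map (μ := P) hX.aemeasurable
  have := Measure.isProbabilityMeasure_map (μ := P) hY.aemeasurable
  have := Measure.isProbabilityMeasure_map (μ := P) hZ.aemeasurable
  rw [hYZ, ← Measure.prodAssoc_prod, ← hXY, ← h,
    Measure.map_map MeasurableEquiv.prodAssoc.measurable (by fun_prop)]
  rfl

theorem ProbabilityTheory.iIndepFun.indepFun_compl_prodMk {ι α β : Type*} [MeasurableSpace α]
    [MeasurableSpace β] {X : ι → Ω → α} (h : iIndepFun X P) (hX : ∀ q, Measurable (X q))
    {Y : Ω → β} (hY : Measurable Y) (hXY : IndepFun (fun ω q => X q ω) Y P) (p : ι) :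
    IndepFun (X p) (fun ω => ((fun q : {q // q ≠ p} => X q ω), Y ω)) P := by
  refine IndepFun.prodMk_right_of_prodMk_left (hX p) (measurable_pi_lambda _ fun q => hX q) hY
    (h.indepFun_compl hX p) ?_
  exact hXY.comp (φ := fun x : ι → α => (x p, fun q : {q // q ≠ p} => x q))
    (by fun_prop) measurable_id

theorem expMeasure_real_Ioi {r : ℝ} (hr : 0 < r) {a : ℝ} (ha : 0 ≤ a) :
    (expMeasure r).real (Set.Ioi a) = Real.exp (-r * a) := by
  have := isProbabilityMeasure_expMeasure hr
  have h := cdf_expMeasure_eq hr a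
  rw [cdf_eq_real, if_pos ha] at h
  rw [← Set.compl_Iic, probReal_compl_eq_one_sub measurableSet_Iic, h]
  ring_nf

/-- The memorylessness of an exponential waiting time that is independent of the past. -/
theorem ProbabilityTheory.IndepFun.integral_mul_ite_lt {α : Type*} [MeasurableSpace α] {r : ℝ}
    (hr : 0 < r) {X : Ω → ℝ} {U : Ω → α} (hX : Measurable X) (hU : Measurable U)
    (hlaw : P.map X = expMeasure r) (h : IndepFun X U P) {F a : α → ℝ} (hF : Measurable F)
    (ha : Measurable a) (hint : Integrable (fun ω => F (U ω)) P)
    (hnonneg : ∀ u, F u ≠ 0 → 0 ≤ a u) :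
    ∫ ω, F (U ω) * (if a (U ω) < X ω then 1 else 0) ∂P =
      ∫ ω, F (U ω) * Real.exp (-r * a (U ω)) ∂P := by
  have := isProbabilityMeasure_expMeasure hr
  have := Measure.isProbabilityMeasure_map (μ := P) hU.aemeasurable
  have hmap := (indepFun_iff_map_prod_eq_prod_map_map hU.aemeasurable hX.aemeasurable).1 h.symm
  rw [hlaw] at hmap
  have hG : Measurable fun p : α × ℝ => F p.1 * (if a p.1 < p.2 then 1 else 0) :=
    (hF.comp measurable_fst).mul (Measurable.ite (measurableSet_lt (ha.comp measurable_fst)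
      measurable_snd) measurable_const measurable_const)
  have hFint : Integrable F (P.map U) :=
    (integrable_map_measure hF.aestronglyMeasurable hU.aemeasurable).2 hint
  have hGint : Integrable (fun p : α × ℝ => F p.1 * (if a p.1 < p.2 then 1 else 0))
      ((P.map U).prod (expMeasure r)) := by
    refine (hFint.comp_fst (expMeasure r)).mono hG.aestronglyMeasurable (.of_forall fun p => ?_)
    split_ifs <;> simp
  calc ∫ ω, F (U ω) * (if a (U ω) < X ω then 1 else 0) ∂P
      = ∫ p, F p.1 * (if a p.1 < p.2 then 1 else 0) ∂((P.map U).prod (expMeasure r)) := by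
        rw [← hmap, integral_map (by fun_prop) hG.aestronglyMeasurable]
    _ = ∫ u, F u * Real.exp (-r * a u) ∂(P.map U) := by
        rw [integral_prod _ hGint]
        refine integral_congr_ae (.of_forall fun u => ?_)
        simp only
        rw [integral_const_mul]
        -- The exponential tail formula needs a nonnegative threshold, which is only known where F
        -- does not vanish.
        by_cases hu : F u = 0
        · simp [hu]
        · have : (fun x : ℝ => if a u < x then (1 : ℝ) else 0) = (Set.Ioi (a u)).indicator 1 := by
            ext x
            simp [Set.indicator_apply]
          rw [this, integral_indicator_one measurableSet_Ioi, expMeasure_real_Ioi hr (hnonneg u hu)]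
    _ = ∫ ω, F (U ω) * Real.exp (-r * a (U ω)) ∂P := by
        rw [integral_map hU.aemeasurable]
        exact (hF.mul (Real.measurable_exp.comp (ha.const_mul _))).aestronglyMeasurable

/-- By the second Borel–Cantelli lemma infinitely many waiting times exceed 1, so their terms do not
tend to 0 and the series diverges. -/
theorem ae_tendsto_sum_atTop {r : ℝ} (hr : 0 < r) {X : ℕ → Ω → ℝ} (hX : ∀ n, Measurable (X n))
    (hlaw : ∀ n, P.map (X n) = expMeasure r) (hind : iIndepFun X P) :
    ∀ᵐ ω ∂P, (∀ n, 0 < X n ω) →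
      Filter.Tendsto (fun n => ∑ k ∈ Finset.range (n + 1), X k ω) Filter.atTop Filter.atTop := by
  have hP : ∀ n, P (X n ⁻¹' Set.Ioi 1) = ENNReal.ofReal (Real.exp (-r * 1)) := by
    intro n
    have := isProbabilityMeasure_expMeasure hr
    rw [← Measure.map_apply (hX n) measurableSet_Ioi, hlaw, ← expMeasure_real_Ioi hr zero_le_one,
      ofReal_measureReal]
  have hset : iIndepSet (fun n => X n ⁻¹' Set.Ioi 1) P := by
    rw [iIndepSet_iff_meas_biInter fun n => hX n measurableSet_Ioi]
    exact fun s => hind.measure_inter_preimage_eq_mul s fun n _ => measurableSet_Ioi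
  have h1 := measure_limsup_eq_one (fun n => hX n measurableSet_Ioi) hset (by
    simp only [hP]
    exact ENNReal.tsum_const_eq_top_of_ne_zero (by simp [Real.exp_pos]))
  have h2 : ∀ᵐ ω ∂P, ω ∈ Filter.limsup (fun n => X n ⁻¹' Set.Ioi 1) Filter.atTop := by
    rw [← mem_ae_iff_prob_eq_one] at h1
    · exact h1
    · exact .measurableSet_limsup fun n => hX n measurableSet_Ioi
  filter_upwards [h2] with ω hω hpos
  rw [Filter.tendsto_add_atTop_iff_nat (f := fun n => ∑ k ∈ Finset.range n, X k ω),
    ← not_summable_iff_tendsto_nat_atTop_of_nonneg fun n => (hpos n).le]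
  intro hs
  rw [Filter.mem_limsup_iff_frequently_mem] at hω
  have h3 := hs.tendsto_atTop_zero.eventually (gt_mem_nhds one_pos)
  obtain ⟨n, hn1, hn2⟩ := (hω.and_eventually h3).exists
  exact absurd hn1 (not_lt.2 hn2.le)

end Independence

/-! ### Almost sure regularity; one value or waiting time against the rest -/

section Random

open Scenario

variable {Ω : Type*} [MeasurableSpace Ω] {N : ℕ} {P : Measure Ω}
  {lam σ : ℝ} {S : Ω → Scenario N}

namespace IsOpenSystem

theorem measurable (hS : IsOpenSystem P lam σ S) : Measurable S :=
  measurable_of_components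
    (measurable_pi_lambda _ fun i => measurable_pi_lambda _ fun n => hS.measurable_value i n)
    (measurable_pi_lambda _ fun j => measurable_pi_lambda _ fun i =>
      measurable_pi_lambda _ fun n => hS.measurable_exch j i n)
    (measurable_pi_lambda _ fun i => measurable_pi_lambda _ fun n => hS.measurable_gap i n)

variable [IsProbabilityMeasure P]

theorem ae_regular (hS : IsOpenSystem P lam σ S) (hlam : 0 < lam) :
    ∀ᵐ ω ∂P, (S ω).Regular := by
  have hpos : ∀ᵐ ω ∂P, ∀ i n, 0 < (S ω).gap i n := by
    rw [ae_all_iff]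
    intro i
    rw [ae_all_iff]
    intro n
    have := isProbabilityMeasure_expMeasure hlam
    have h : ∀ᵐ x ∂(P.map fun ω => (S ω).gap i n), 0 < x := by
      rw [hS.gap_law]
      have h := expMeasure_real_Ioi hlam le_rfl
      rw [mul_zero, Real.exp_zero, measureReal_def, ENNReal.toReal_eq_one_iff] at h
      exact (mem_ae_iff_prob_eq_one measurableSet_Ioi).2 h
    exact ae_of_ae_map (hS.measurable_gap i n).aemeasurable h
  have htend : ∀ᵐ ω ∂P, ∀ i, (∀ n, 0 < (S ω).gap i n) →
      Filter.Tendsto ((S ω).replTime i) Filter.atTop Filter.atTop := by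
    rw [ae_all_iff]
    intro i
    exact ae_tendsto_sum_atTop hlam (fun n => hS.measurable_gap i n) (fun n => hS.gap_law i n)
      (hS.gap_indep.precomp (g := fun n => (i, n)) fun a b h => (Prod.ext_iff.1 h).2)
  filter_upwards [hpos, htend, hS.exch_pos, hS.exch_locallyFinite] with ω h1 h2 h3 h4
  exact ⟨h1, fun i => h2 i (h1 i), h3, h4⟩

/-- Once the m-th value of `j` is overwritten by a constant, the scenario is a measurable function
of the other values, the exchanges and the waiting times. -/
theorem indepFun_value_setValue (hS : IsOpenSystem P lam σ S) (j : Fin N) (m : ℕ) (c : ℝ) :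
    IndepFun (fun ω => (S ω).value j m) (fun ω => (S ω).setValue j m c) P := by
  have hm := hS.measurable
  have hv : Measurable fun ω => (S ω).value := Scenario.measurable_value.comp hm
  have he : Measurable fun ω => (S ω).exch := Scenario.measurable_exch.comp hm
  have hg : Measurable fun ω => (S ω).gap := Scenario.measurable_gap.comp hm
  -- The two independence hypotheses combine to full mutual independence of values, exchanges and
  -- waiting times.
  have h1 : IndepFun (fun ω => (S ω).value) (fun ω => ((S ω).exch, (S ω).gap)) P :=
    IndepFun.prodMk_right_of_prodMk_left hv he hg
      (hS.exch_indep.symm.comp (φ := Prod.fst) measurable_fst measurable_id) hS.repl_indep.symm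
  have h3 : IndepFun (fun ω (p : Fin N × ℕ) => (S ω).value p.1 p.2)
      (fun ω => ((S ω).exch, (S ω).gap)) P :=
    h1.comp (φ := fun (v : Fin N → ℕ → ℝ) (p : Fin N × ℕ) => v p.1 p.2) (by fun_prop) measurable_id
  have h2 := hS.value_indep.indepFun_compl_prodMk (fun p => hS.measurable_value p.1 p.2)
    (he.prodMk hg) h3 (j, m)
  let ψ : ({q : Fin N × ℕ // q ≠ (j, m)} → ℝ) ×
      ((Fin N → Fin N → ℕ → EReal) × (Fin N → ℕ → ℝ)) → Scenario N := fun r =>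
    { value := fun k n => if h : (k, n) ≠ (j, m) then r.1 ⟨(k, n), h⟩ else c
      exch := r.2.1
      gap := r.2.2 }
  have hψ : Measurable ψ := by
    refine measurable_of_components ?_ measurable_snd.fst measurable_snd.snd
    refine measurable_pi_lambda _ fun k => measurable_pi_lambda _ fun n => ?_
    by_cases h : (k, n) ≠ (j, m)
    · simp only [ψ, dif_pos h]
      fun_prop
    · simp only [ψ, dif_neg h]
      fun_prop
  convert! h2.comp measurable_id hψ using 1
  ext ω
  simp only [ψ, Function.comp_apply, setValue]
  congr 1
  ext k n
  by_cases hk : k = j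
  · subst hk
    by_cases hn : n = m
    · subst hn; simp
    · simp [hn]
  · simp [hk]

theorem indepFun_gap_setGap (hS : IsOpenSystem P lam σ S) (j : Fin N) (m : ℕ) (c : ℝ) :
    IndepFun (fun ω => (S ω).gap j m) (fun ω => (S ω).setGap j m c) P := by
  have hm := hS.measurable
  have hv : Measurable fun ω => (S ω).value := Scenario.measurable_value.comp hm
  have he : Measurable fun ω => (S ω).exch := Scenario.measurable_exch.comp hm
  have h3 : IndepFun (fun ω (p : Fin N × ℕ) => (S ω).gap p.1 p.2)
      (fun ω => ((S ω).value, (S ω).exch)) P :=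
    hS.repl_indep.comp (φ := fun (v : Fin N → ℕ → ℝ) (p : Fin N × ℕ) => v p.1 p.2) (by fun_prop)
      measurable_id
  have h2 := hS.gap_indep.indepFun_compl_prodMk (fun p => hS.measurable_gap p.1 p.2)
    (hv.prodMk he) h3 (j, m)
  let ψ : ({q : Fin N × ℕ // q ≠ (j, m)} → ℝ) ×
      ((Fin N → ℕ → ℝ) × (Fin N → Fin N → ℕ → EReal)) → Scenario N := fun r =>
    { gap := fun k n => if h : (k, n) ≠ (j, m) then r.1 ⟨(k, n), h⟩ else c
      value := r.2.1
      exch := r.2.2 }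
  have hψ : Measurable ψ := by
    refine measurable_of_components measurable_snd.fst measurable_snd.snd ?_
    refine measurable_pi_lambda _ fun k => measurable_pi_lambda _ fun n => ?_
    by_cases h : (k, n) ≠ (j, m)
    · simp only [ψ, dif_pos h]
      fun_prop
    · simp only [ψ, dif_neg h]
      fun_prop
  convert! h2.comp measurable_id hψ using 1
  ext ω
  simp only [ψ, Function.comp_apply, setGap]
  congr 1
  ext k n
  by_cases hk : k = j
  · subst hk
    by_cases hn : n = m
    · subst hn; simp
    · simp [hn]
  · simp [hk]

end IsOpenSystem

end Random

/-! ### The discount and the estimate -/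

namespace Scenario

variable {N : ℕ}

theorem numRepl_setValue (ε : Scenario N) (j k : Fin N) (m : ℕ) (c s : ℝ) :
    (ε.setValue j m c).numRepl k s = ε.numRepl k s := rfl

theorem lastContact_setValue {ε : Scenario N} {i j : Fin N} {t c : ℝ} {m : ℕ} :
    (ε.setValue j m c).lastContact j i t = ε.lastContact j i t := by
  have : (ε.setValue j m c).contactSet j i t = ε.contactSet j i t :=
    contactSet_congr rfl fun k hk u => Iff.rfl
  rw [lastContact, this, lastContact]

theorem lastContact_le (ε : Scenario N) (j i : Fin N) (t : ℝ) :
    ε.lastContact j i t ≤ (t : EReal) := by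
  refine sSup_le ?_
  rintro _ ⟨s, hs, rfl⟩
  exact EReal.coe_le_coe_iff.2 (le_of_mem_contactSet hs)

theorem toReal_lastContact_le {ε : Scenario N} {j i : Fin N} {t : ℝ}
    (h : ε.lastContact j i t ≠ ⊥) : (ε.lastContact j i t).toReal ≤ t := by
  simpa using EReal.toReal_le_toReal (ε.lastContact_le j i t) h (EReal.coe_ne_top t)

theorem measurable_numRepl_apply (j : Fin N) (t : ℝ) :
    Measurable fun ε : Scenario N => ε.numRepl j t :=
  (measurable_numRepl j).comp (g := fun q : Scenario N × ℝ => q.1.numRepl j q.2)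
    (f := fun ε => (ε, t)) (measurable_id.prodMk measurable_const)

theorem measurable_numRepl_lastContact (j i : Fin N) (t : ℝ) :
    Measurable fun ε : Scenario N => ε.numRepl j (ε.lastContact j i t).toReal :=
  (measurable_numRepl j).comp (g := fun q : Scenario N × ℝ => q.1.numRepl j q.2)
    (f := fun ε => (ε, (ε.lastContact j i t).toReal))
    (measurable_id.prodMk (measurable_lastContact j i t).ereal_toReal)

theorem measurableSet_lastContact_ne_bot (j i : Fin N) (t : ℝ) :
    MeasurableSet {ε : Scenario N | ε.lastContact j i t ≠ ⊥} :=
  (measurable_lastContact j i t (measurableSet_singleton ⊥)).compl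

theorem measurableSet_numRepl_lastContact_eq (j i : Fin N) (t : ℝ) (m : ℕ) :
    MeasurableSet {ε : Scenario N | ε.lastContact j i t ≠ ⊥ ∧
      ε.numRepl j (ε.lastContact j i t).toReal = m} :=
  (measurableSet_lastContact_ne_bot j i t).inter
    (measurable_numRepl_lastContact j i t (measurableSet_singleton m))

theorem measurable_setGap (j : Fin N) (m : ℕ) (c : ℝ) :
    Measurable fun ε : Scenario N => ε.setGap j m c := by
  refine measurable_of_components measurable_value measurable_exch ?_
  refine measurable_pi_lambda _ fun k => measurable_pi_lambda _ fun n => ?_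
  by_cases hk : k = j
  · subst hk
    by_cases hn : n = m
    · subst hn; simp [setGap]
    · simpa [setGap, Function.update_of_ne hn] using measurable_gap_apply k n
  · simpa [setGap, Function.update_of_ne hk] using measurable_gap_apply k n

/-- The discount factor of the most recent information that `i` has at time `t` about `j`. -/
noncomputable def discount (lam : ℝ) (j i : Fin N) (t : ℝ) (ε : Scenario N) : ℝ :=
  {ε : Scenario N | ε.lastContact j i t ≠ ⊥}.indicator
    (fun ε => Real.exp (-lam * (t - (ε.lastContact j i t).toReal))) ε

theorem measurable_discount (lam : ℝ) (j i : Fin N) (t : ℝ) :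
    Measurable (discount lam j i t) :=
  Measurable.indicator (Real.measurable_exp.comp
    ((measurable_const.sub (measurable_lastContact j i t).ereal_toReal).const_mul _))
    (measurableSet_lastContact_ne_bot j i t)

theorem discount_nonneg (lam : ℝ) (j i : Fin N) (t : ℝ) (ε : Scenario N) :
    0 ≤ discount lam j i t ε :=
  Set.indicator_nonneg (fun _ _ => (Real.exp_pos _).le) _

theorem discount_le_one {lam : ℝ} (hlam : 0 < lam) (j i : Fin N) (t : ℝ) (ε : Scenario N) :
    discount lam j i t ε ≤ 1 := by
  refine Set.indicator_apply_le' (fun h => ?_) fun _ => zero_le_one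
  rw [Real.exp_le_one_iff]
  nlinarith [toReal_lastContact_le h]

theorem discount_sq (lam : ℝ) (j i : Fin N) (t : ℝ) (ε : Scenario N) :
    discount lam j i t ε ^ 2 = discount (2 * lam) j i t ε := by
  by_cases h : ε ∈ {ε : Scenario N | ε.lastContact j i t ≠ ⊥}
  · rw [discount, discount, Set.indicator_of_mem h, Set.indicator_of_mem h, ← Real.exp_nat_mul]
    congr 1
    push_cast
    ring
  · simp [discount, Set.indicator_of_notMem h]

/-- The optimal estimate by `i` of the value that `j` holds at time `t`. -/
noncomputable def contactEstimate (lam : ℝ) (j i : Fin N) (t : ℝ) (ε : Scenario N) : ℝ :=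
  discount lam j i t ε * ε.agentValue j (ε.lastContact j i t).toReal

theorem measurable_contactEstimate (lam : ℝ) (j i : Fin N) (t : ℝ) :
    Measurable (contactEstimate lam j i t) :=
  (measurable_discount lam j i t).mul ((measurable_agentValue j).comp
    (measurable_id.prodMk (measurable_lastContact j i t).ereal_toReal))

end Scenario

/-! ### Second moments and integrals over events of the knowledge set -/

section Random

open Scenario

variable {Ω : Type*} [MeasurableSpace Ω] {N : ℕ} {P : Measure Ω}
  {lam σ : ℝ} {S : Ω → Scenario N}

namespace IsOpenSystem

theorem measurable_agentValue (hS : IsOpenSystem P lam σ S) (j : Fin N) (t : ℝ) :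
    Measurable fun ω => (S ω).agentValue j t :=
  (Scenario.measurable_agentValue j).comp (hS.measurable.prodMk measurable_const)

variable [IsProbabilityMeasure P]

theorem integrable_value (hS : IsOpenSystem P lam σ S) (j : Fin N) (m : ℕ) :
    Integrable (fun ω => (S ω).value j m) P :=
  (hS.value_memLp j m).integrable (by norm_num)

/-- Split according to the random index. On each piece the weight ignores the value selected, so
independence factors out the second moment σ². With nonnegative integrals this needs no prior
integrability and yields it afterwards. -/
theorem lintegral_mul_value_sq (hS : IsOpenSystem P lam σ S) (j : Fin N) {n : Scenario N → ℕ}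
    {W : Scenario N → ENNReal} (hn : Measurable n) (hW : Measurable W)
    (hn' : ∀ ε m, n (ε.setValue j m 0) = n ε) (hW' : ∀ ε m, W (ε.setValue j m 0) = W ε) :
    ∫⁻ ω, W (S ω) * ENNReal.ofReal ((S ω).value j (n (S ω)) ^ 2) ∂P =
      (∫⁻ ω, W (S ω) ∂P) * ENNReal.ofReal (σ ^ 2) := by
  classical
  have hm := hS.measurable
  have hV : ∀ m, Measurable fun ε : Scenario N => (if n ε = m then W ε else 0) := fun m =>
    Measurable.ite (hn (measurableSet_singleton m)) hW measurable_const
  have hsq : ∀ m, Measurable fun ω => ENNReal.ofReal ((S ω).value j m ^ 2) := fun m =>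
    ((hS.measurable_value j m).pow_const 2).ennreal_ofReal
  have h1 : ∀ ω, W (S ω) * ENNReal.ofReal ((S ω).value j (n (S ω)) ^ 2) =
      ∑' m, (if n (S ω) = m then W (S ω) else 0) * ENNReal.ofReal ((S ω).value j m ^ 2) := by
    intro ω
    rw [tsum_eq_single (n (S ω)) fun m hm => by simp [hm.symm]]
    simp
  have h2 : ∀ ω, W (S ω) = ∑' m, (if n (S ω) = m then W (S ω) else 0) := by
    intro ω
    rw [tsum_eq_single (n (S ω)) fun m hm => by simp [hm.symm]]
    simp
  have h3 : ∀ m, ∫⁻ ω, ENNReal.ofReal ((S ω).value j m ^ 2) ∂P = ENNReal.ofReal (σ ^ 2) := by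
    intro m
    rw [← ofReal_integral_eq_lintegral_ofReal (hS.value_memLp j m).integrable_sq
      (.of_forall fun ω => sq_nonneg _), hS.value_var]
  simp_rw [h1]
  have hVS : ∀ m, Measurable fun ω => (if n (S ω) = m then W (S ω) else 0) := fun m =>
    (hV m).comp hm
  have hVsq : ∀ m, Measurable fun ω => (if n (S ω) = m then W (S ω) else 0) *
      ENNReal.ofReal ((S ω).value j m ^ 2) := fun m => (hVS m).mul (hsq m)
  rw [lintegral_congr h2, lintegral_tsum fun m => (hVsq m).aemeasurable,
    lintegral_tsum fun m => (hVS m).aemeasurable, ← ENNReal.tsum_mul_right]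
  refine tsum_congr fun m => ?_
  have hind := (hS.indepFun_value_setValue j m 0).symm.comp (hV m)
    (φ := fun ε : Scenario N => (if n ε = m then W ε else 0))
    (ψ := fun x : ℝ => ENNReal.ofReal (x ^ 2)) (by fun_prop)
  have hmul := lintegral_mul_eq_lintegral_mul_lintegral_of_indepFun
    ((hV m).comp ((measurable_setValue j m 0).comp hm)) (hsq m) hind
  simp only [Pi.mul_apply, Function.comp_apply, hn', hW', h3] at hmul
  exact hmul

theorem integrable_mul_value_sq (hS : IsOpenSystem P lam σ S) (j : Fin N) {n : Scenario N → ℕ}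
    {w : Scenario N → ℝ} (hn : Measurable n) (hw : Measurable w) (hw0 : ∀ ε, 0 ≤ w ε)
    (hw1 : ∀ ε, w ε ≤ 1)
    (hn' : ∀ ε m, n (ε.setValue j m 0) = n ε) (hw' : ∀ ε m, w (ε.setValue j m 0) = w ε) :
    Integrable (fun ω => w (S ω) * (S ω).value j (n (S ω)) ^ 2) P ∧
      ∫ ω, w (S ω) * (S ω).value j (n (S ω)) ^ 2 ∂P = (∫ ω, w (S ω) ∂P) * σ ^ 2 := by
  have hm := hS.measurable
  have hval : Measurable fun p : Scenario N × ℕ => p.1.value j p.2 :=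
    measurable_from_prod_countable_left fun n => measurable_value_apply j n
  have hmeas : Measurable fun ω => w (S ω) * (S ω).value j (n (S ω)) ^ 2 :=
    (hw.comp hm).mul ((hval.comp (hm.prodMk (hn.comp hm))).pow_const 2)
  have hnn : ∀ ω, 0 ≤ w (S ω) * (S ω).value j (n (S ω)) ^ 2 :=
    fun ω => mul_nonneg (hw0 _) (sq_nonneg _)
  have hwint : Integrable (fun ω => w (S ω)) P :=
    Integrable.of_bound (hw.comp hm).aestronglyMeasurable 1
      (.of_forall fun ω => by rw [Real.norm_of_nonneg (hw0 _)]; exact hw1 _)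
  have key := hS.lintegral_mul_value_sq j hn hw.ennreal_ofReal hn' fun ε m => by rw [hw']
  simp_rw [← ENNReal.ofReal_mul (hw0 _)] at key
  rw [← ofReal_integral_eq_lintegral_ofReal hwint (.of_forall fun ω => hw0 _),
    ← ENNReal.ofReal_mul (integral_nonneg fun ω => hw0 _)] at key
  refine ⟨⟨hmeas.aestronglyMeasurable, ?_⟩, ?_⟩
  · rw [hasFiniteIntegral_iff_ofReal (.of_forall hnn), key]
    exact ENNReal.ofReal_lt_top
  · rw [integral_eq_lintegral_of_nonneg_ae (.of_forall hnn) hmeas.aestronglyMeasurable, key,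
      ENNReal.toReal_ofReal (mul_nonneg (integral_nonneg fun ω => hw0 _) (sq_nonneg _))]

theorem integral_agentValue_sq (hS : IsOpenSystem P lam σ S) (j : Fin N) (t : ℝ) :
    MemLp (fun ω => (S ω).agentValue j t) 2 P ∧ ∫ ω, (S ω).agentValue j t ^ 2 ∂P = σ ^ 2 := by
  have h := hS.integrable_mul_value_sq j (n := fun ε => ε.numRepl j t) (w := fun _ => 1)
    (measurable_numRepl_apply j t) measurable_const (fun _ => zero_le_one) (fun _ => le_rfl)
    (fun _ _ => rfl) (fun _ _ => rfl)
  simp only [one_mul, integral_const, probReal_univ, smul_eq_mul] at h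
  exact ⟨(memLp_two_iff_integrable_sq (hS.measurable_agentValue j t).aestronglyMeasurable).2 h.1,
    h.2⟩

theorem integral_contactEstimate_sq (hS : IsOpenSystem P lam σ S) (hlam : 0 < lam) (j i : Fin N)
    (t : ℝ) :
    MemLp (fun ω => contactEstimate lam j i t (S ω)) 2 P ∧
      ∫ ω, contactEstimate lam j i t (S ω) ^ 2 ∂P =
        (∫ ω, discount (2 * lam) j i t (S ω) ∂P) * σ ^ 2 := by
  have h := hS.integrable_mul_value_sq j
    (n := fun ε => ε.numRepl j (ε.lastContact j i t).toReal) (w := discount (2 * lam) j i t)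
    (measurable_numRepl_lastContact j i t) (measurable_discount _ j i t) (discount_nonneg _ j i t)
    (discount_le_one (by positivity) j i t)
    (fun ε m => by rw [lastContact_setValue, numRepl_setValue])
    (fun ε m => by simp only [discount, Set.indicator, Set.mem_ofPred_eq, lastContact_setValue])
  have hsq : ∀ ω, discount (2 * lam) j i t (S ω) *
      (S ω).value j ((S ω).numRepl j ((S ω).lastContact j i t).toReal) ^ 2 =
      contactEstimate lam j i t (S ω) ^ 2 := fun ω => by
    rw [contactEstimate, mul_pow, discount_sq, agentValue]
  simp_rw [hsq] at h
  exact ⟨(memLp_two_iff_integrable_sq ((measurable_contactEstimate lam j i t).comp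
    hS.measurable).aestronglyMeasurable).2 h.1, h.2⟩

/-- Here holder m is present at time t but not at a last contact, so its value never reaches `i`.
The event does not change when this value is overwritten; hence it is independent of the value,
whose mean is 0. -/
theorem setIntegral_value_eq_zero (hS : IsOpenSystem P lam σ S) (hlam : 0 < lam) {i j : Fin N}
    (hij : i ≠ j) (t : ℝ) (m : ℕ) {A : Set (Set (Info N))}
    (hA : MeasurableSet[hitMeasurableSpace N] A) :
    ∫ ω in S ⁻¹' (({ε | ε.knowledgeSet i t ∈ A} ∩ {ε | ε.numRepl j t = m}) \
      {ε | ε.lastContact j i t ≠ ⊥ ∧ ε.numRepl j (ε.lastContact j i t).toReal = m}),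
      (S ω).value j m ∂P = 0 := by
  set B : Set (Scenario N) := ({ε | ε.knowledgeSet i t ∈ A} ∩ {ε | ε.numRepl j t = m}) \
      {ε | ε.lastContact j i t ≠ ⊥ ∧ ε.numRepl j (ε.lastContact j i t).toReal = m} with hB
  have hm := hS.measurable
  have hBm : MeasurableSet B := ((measurable_knowledgeSet i t hA).inter
    (measurable_numRepl_apply j t (measurableSet_singleton m))).diff
    (measurableSet_numRepl_lastContact_eq j i t m)
  have hae : ∀ᵐ ω ∂P, (S ⁻¹' B).indicator (fun ω => (S ω).value j m) ω =
      (S ω).value j m * B.indicator 1 ((S ω).setValue j m 0) := by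
    filter_upwards [hS.ae_regular hlam] with ω hω
    have hiff : S ω ∈ B ↔ (S ω).setValue j m 0 ∈ B := by
      simp only [hB, Set.mem_sdiff, Set.mem_inter_iff, Set.mem_ofPred_eq, lastContact_setValue,
        numRepl_setValue]
      -- The knowledge sets need to agree only under the remaining conditions. Those force the index
      -- to be below m up to the last contact, by monotonicity in time.
      by_cases hcond : (S ω).numRepl j t = m ∧ ¬ ((S ω).lastContact j i t ≠ ⊥ ∧
          (S ω).numRepl j ((S ω).lastContact j i t).toReal = m)
      · rw [knowledgeSet_setValue hij]
        intro u hu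
        have hne : (S ω).lastContact j i t ≠ ⊥ := by
          intro h
          rw [h] at hu
          exact EReal.coe_ne_bot u (le_bot_iff.1 hu)
        obtain ⟨v, hv, -, hvt, -⟩ := hω.exists_lastContact hij hne
        rw [hv] at hu
        have hne' : (S ω).numRepl j v ≠ m := fun h => hcond.2 ⟨hne, by rw [hv]; exact h⟩
        have h1 := hω.numRepl_mono (i := j) (EReal.coe_le_coe_iff.1 hu)
        have h2 := hω.numRepl_mono (i := j) hvt
        rw [hcond.1] at h2
        omega
      · tauto
    by_cases h : S ω ∈ B
    · rw [Set.indicator_of_mem (show ω ∈ S ⁻¹' B from h), Set.indicator_of_mem (hiff.1 h)]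
      simp
    · rw [Set.indicator_of_notMem (show ω ∉ S ⁻¹' B from h),
        Set.indicator_of_notMem (fun h' => h (hiff.2 h'))]
      simp
  rw [← integral_indicator (hm hBm), integral_congr_ae hae]
  have hind := (hS.indepFun_value_setValue j m 0).comp (φ := id) (ψ := B.indicator (1 : Scenario N → ℝ))
    measurable_id (measurable_one.indicator hBm)
  have := hind.integral_fun_mul_eq_mul_integral
    (hS.measurable_value j m).aestronglyMeasurable
    (((measurable_one.indicator hBm).comp
      ((measurable_setValue j m 0).comp hm)).aestronglyMeasurable)
  simp only [Function.comp_apply, id_eq] at this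
  rw [this, hS.value_mean, zero_mul]

/-- Given everything except the m-th waiting time, the two sides ask holder m to survive until t and
until L. Both probabilities are exponential in the time since its arrival, and their quotient is the
discount. -/
theorem setIntegral_value_eq_discount (hS : IsOpenSystem P lam σ S) (hlam : 0 < lam) {i j : Fin N}
    (hij : i ≠ j) (t : ℝ) (m : ℕ) {A : Set (Set (Info N))}
    (hA : MeasurableSet[hitMeasurableSpace N] A) :
    ∫ ω in S ⁻¹' (({ε | ε.knowledgeSet i t ∈ A} ∩ {ε | ε.numRepl j t = m}) ∩
      {ε | ε.lastContact j i t ≠ ⊥ ∧ ε.numRepl j (ε.lastContact j i t).toReal = m}),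
      (S ω).value j m ∂P =
    ∫ ω in S ⁻¹' ({ε | ε.knowledgeSet i t ∈ A} ∩
      {ε | ε.lastContact j i t ≠ ⊥ ∧ ε.numRepl j (ε.lastContact j i t).toReal = m}),
      contactEstimate lam j i t (S ω) ∂P := by
  classical
  set C : Set (Scenario N) :=
    {ε | ε.lastContact j i t ≠ ⊥ ∧ ε.numRepl j (ε.lastContact j i t).toReal = m} with hC
  have hm := hS.measurable
  have hAm : MeasurableSet {ε : Scenario N | ε.knowledgeSet i t ∈ A} :=
    measurable_knowledgeSet i t hA
  have hCm : MeasurableSet C := measurableSet_numRepl_lastContact_eq j i t m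
  have hEm : MeasurableSet {ε : Scenario N | ε.numRepl j t = m} :=
    measurable_numRepl_apply j t (measurableSet_singleton m)
  let τ : Scenario N → ℝ := fun ε => (ε.lastContact j i t).toReal
  have hτ : Measurable τ := (measurable_lastContact j i t).ereal_toReal
  -- Any constant above t would do: `U` forgets the m-th waiting time but keeps the knowledge set
  -- when holder m is present at the last contact.
  let U : Ω → Scenario N := fun ω => (S ω).setGap j m (t + 1)
  have hU : Measurable U := (measurable_setGap j m (t + 1)).comp hm
  have hUτ : ∀ ω, τ (U ω) = τ (S ω) := fun ω => by simp only [τ, U, lastContact_setGap]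
  have hUarr : ∀ ω, (U ω).arrival j m = (S ω).arrival j m := fun ω => arrival_setGap le_rfl _
  -- the part of the integrands that does not depend on the `m`-th waiting time of `j`
  let G : Set (Scenario N) := {ε | ε.lastContact j i t ≠ ⊥} ∩
    ({ε | ε.arrival j m ≤ τ ε} ∩ {ε | ε.knowledgeSet i t ∈ A})
  have hG : MeasurableSet G := (measurableSet_lastContact_ne_bot j i t).inter
    ((measurableSet_le (measurable_arrival j m) hτ).inter hAm)
  let F : Scenario N → ℝ := G.indicator fun ε => ε.value j m
  have hF : Measurable F := (measurable_value_apply j m).indicator hG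
  have hFint : Integrable (fun ω => F (U ω)) P := by
    refine (hS.integrable_value j m).mono (hF.comp hU).aestronglyMeasurable (.of_forall fun ω => ?_)
    exact norm_indicator_le_norm_self (fun ε : Scenario N => ε.value j m) (U ω)
  have hFG : ∀ ε, F ε ≠ 0 → ε ∈ G := fun ε h => Set.mem_of_indicator_ne_zero h
  have hind := hS.indepFun_gap_setGap j m (t + 1)
  have e1 := hind.integral_mul_ite_lt hlam (hS.measurable_gap j m) hU (hS.gap_law j m) hF
    (a := fun ε => t - ε.arrival j m) (measurable_const.sub (measurable_arrival j m)) hFint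
    (fun ε h => by
      have h' := hFG ε h
      have h1 : ε.arrival j m ≤ τ ε := h'.2.1
      have h2 : τ ε ≤ t := toReal_lastContact_le h'.1
      linarith)
  let F' : Scenario N → ℝ := fun ε => F ε * discount lam j i t ε
  have hF' : Measurable F' := hF.mul (measurable_discount lam j i t)
  have hF'int : Integrable (fun ω => F' (U ω)) P := by
    refine hFint.mono (hF'.comp hU).aestronglyMeasurable (.of_forall fun ω => ?_)
    simp only [F', norm_mul, Real.norm_of_nonneg (discount_nonneg lam j i t (U ω))]
    exact mul_le_of_le_one_right (norm_nonneg _) (discount_le_one hlam j i t _)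
  have e2 := hind.integral_mul_ite_lt hlam (hS.measurable_gap j m) hU (hS.gap_law j m) hF'
    (a := fun ε => τ ε - ε.arrival j m) (hτ.sub (measurable_arrival j m)) hF'int
    (fun ε h => by
      have h1 : ε.arrival j m ≤ τ ε := (hFG ε (left_ne_zero_of_mul h)).2.1
      linarith)
  -- The time from arrival to t splits at the last contact, so the exponentials multiply.
  have e3 : ∀ ω, F (U ω) * Real.exp (-lam * (t - (U ω).arrival j m)) =
      F' (U ω) * Real.exp (-lam * (τ (U ω) - (U ω).arrival j m)) := by
    intro ω
    by_cases h : F (U ω) = 0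
    · simp [F', h]
    · have h1 := (hFG _ h).1
      simp only [F', discount, Set.indicator_of_mem h1, mul_assoc, ← Real.exp_add]
      congr 2
      simp only [τ]
      ring
  -- Both survival times, a = L and a = t, are treated at once. Survival past a ≥ L reduces presence
  -- at L to having arrived by L, which `U` still sees.
  have hreg : ∀ ω, (S ω).Regular → ∀ a : ℝ, a = τ (S ω) ∨ a = t →
      F (U ω) * (if a - (U ω).arrival j m < (S ω).gap j m then 1 else 0) =
        if (S ω).knowledgeSet i t ∈ A ∧ S ω ∈ C ∧ a < (S ω).arrival j (m + 1) then
          (S ω).value j m else 0 := by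
    intro ω hω a ha
    have hlt : a - (U ω).arrival j m < (S ω).gap j m ↔ a < (S ω).arrival j (m + 1) := by
      rw [hUarr, arrival_succ]
      constructor <;> intro h <;> linarith
    by_cases hne : (S ω).lastContact j i t ≠ ⊥
    swap
    · have h1 : U ω ∉ G := fun h => by
        have := h.1
        simp only [Set.mem_ofPred_eq, U, lastContact_setGap] at this
        exact hne this
      rw [show F (U ω) = 0 from Set.indicator_of_notMem h1 _, zero_mul, if_neg]
      exact fun h => hne h.2.1.1
    obtain ⟨v, hv, hv0, hvt, -⟩ := hω.exists_lastContact hij hne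
    have hτv : τ (S ω) = v := by simp only [τ, hv, EReal.toReal_coe]
    have hva : v ≤ a := by
      rcases ha with rfl | rfl
      · exact hτv.ge
      · exact hvt
    by_cases hB : a < (S ω).arrival j (m + 1)
    swap
    · rw [if_neg (fun h => hB (hlt.1 h)), mul_zero, if_neg]
      exact fun h => hB h.2.2
    rw [if_pos (hlt.2 hB), mul_one]
    have hCiff : S ω ∈ C ↔ (S ω).arrival j m ≤ v := by
      simp only [hC, Set.mem_ofPred_eq, hv, EReal.toReal_coe]
      rw [hω.numRepl_eq_iff hv0.le]
      exact ⟨fun h => h.2.1, fun h => ⟨EReal.coe_ne_bot v, h, hva.trans_lt hB⟩⟩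
    have hiff : U ω ∈ G ↔
        (S ω).knowledgeSet i t ∈ A ∧ S ω ∈ C ∧ a < (S ω).arrival j (m + 1) := by
      by_cases hc : S ω ∈ C
      · have hK : (U ω).knowledgeSet i t = (S ω).knowledgeSet i t :=
          hω.knowledgeSet_setGap hij (lt_add_one t) hne hc.2
        simp only [G, Set.mem_inter_iff, Set.mem_ofPred_eq, hUτ, hUarr, hK, hτv, hc, hB]
        simp only [U, lastContact_setGap]
        have := hCiff.1 hc
        tauto
      · refine ⟨fun h => absurd ?_ hc, fun h => absurd h.2.1 hc⟩
        rw [hCiff, ← hτv, ← hUτ, ← hUarr]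
        exact h.2.1
    by_cases hmem : U ω ∈ G
    · rw [if_pos (hiff.1 hmem)]
      exact Set.indicator_of_mem hmem _
    · rw [if_neg (fun h => hmem (hiff.2 h))]
      exact Set.indicator_of_notMem hmem _
  have hCt : ∀ ω, (S ω).Regular → S ω ∈ C → ((S ω).arrival j m ≤ τ (S ω) ∧
      τ (S ω) < (S ω).arrival j (m + 1)) ∧ 0 ≤ τ (S ω) ∧ τ (S ω) ≤ t := by
    intro ω hω hc
    obtain ⟨v, hv, hv0, hvt, -⟩ := hω.exists_lastContact hij hc.1
    have hτv : τ (S ω) = v := by simp only [τ, hv, EReal.toReal_coe]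
    rw [hτv]
    have h := hc.2
    rw [hv, EReal.toReal_coe, hω.numRepl_eq_iff hv0.le] at h
    exact ⟨h, hv0.le, hvt⟩
  have l1 : ∀ᵐ ω ∂P, F (U ω) * (if t - (U ω).arrival j m < (S ω).gap j m then 1 else 0) =
      (S ⁻¹' ({ε | ε.knowledgeSet i t ∈ A} ∩ {ε | ε.numRepl j t = m} ∩ C)).indicator
        (fun ω => (S ω).value j m) ω := by
    filter_upwards [hS.ae_regular hlam] with ω hω
    rw [hreg ω hω t (.inr rfl), Set.indicator_apply]
    refine if_congr ?_ rfl rfl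
    simp only [Set.mem_preimage, Set.mem_inter_iff, Set.mem_ofPred_eq]
    by_cases hc : S ω ∈ C
    · obtain ⟨h1, h2, h3⟩ := hCt ω hω hc
      have := hω.numRepl_eq_iff (i := j) (m := m) (h2.trans h3)
      have := h1.1.trans h3
      tauto
    · tauto
  have l2 : ∀ᵐ ω ∂P, F' (U ω) * (if τ (U ω) - (U ω).arrival j m < (S ω).gap j m then 1 else 0) =
      (S ⁻¹' ({ε | ε.knowledgeSet i t ∈ A} ∩ C)).indicator
        (fun ω => contactEstimate lam j i t (S ω)) ω := by
    filter_upwards [hS.ae_regular hlam] with ω hω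
    have hd : discount lam j i t (U ω) = discount lam j i t (S ω) := by
      simp only [discount, Set.indicator, Set.mem_ofPred_eq, U, lastContact_setGap]
    simp only [F']
    rw [mul_right_comm, hUτ, hreg ω hω _ (.inl rfl), Set.indicator_apply, ite_mul, zero_mul, hd]
    by_cases hc : S ω ∈ C
    · have := (hCt ω hω hc).1.2
      refine if_congr ?_ ?_ rfl
      · simp only [Set.mem_preimage, Set.mem_inter_iff, Set.mem_ofPred_eq]
        tauto
      · rw [contactEstimate, agentValue, hc.2, mul_comm]
    · rw [if_neg (fun h => hc h.2.1), if_neg (fun h => hc h.2)]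
  rw [← integral_indicator (hm ((hAm.inter hEm).inter hCm)),
    ← integral_indicator (hm (hAm.inter hCm)), ← integral_congr_ae l1, ← integral_congr_ae l2,
    e1, e2]
  exact integral_congr_ae (.of_forall e3)

end IsOpenSystem

end Random

/-! ### The conditional expectation and the mean error -/

namespace Scenario

theorem stronglyMeasurable_comp_knowledgeSet {Ω : Type*} {N : ℕ} {S : Ω → Scenario N}
    {f : Set (Info N) → ℝ}
    (hf : Measurable[hitMeasurableSpace N] f) (i : Fin N) (t : ℝ) :
    StronglyMeasurable[knowledgeSigma S i t] fun ω => f ((S ω).knowledgeSet i t) :=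
  Measurable.stronglyMeasurable
    (hf.comp (comap_measurable (m := hitMeasurableSpace N) fun ω => (S ω).knowledgeSet i t))

theorem measurable_recentValue_toReal {N : ℕ} (j : Fin N) :
    Measurable[hitMeasurableSpace N] fun K : Set (Info N) => (recentValue j K).toReal :=
  let _ : MeasurableSpace (Set (Info N)) := hitMeasurableSpace N
  (measurable_recentValue j).ereal_toReal

end Scenario

section Random

open Scenario

variable {Ω : Type*} [mΩ : MeasurableSpace Ω] {N : ℕ} {P : Measure Ω} {lam σ : ℝ}
  {S : Ω → Scenario N}

namespace IsOpenSystem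

theorem knowledgeSigma_le (hS : IsOpenSystem P lam σ S) (i : Fin N) (t : ℝ) :
    knowledgeSigma S i t ≤ mΩ :=
  measurable_iff_comap_le.1 ((measurable_knowledgeSet i t).comp hS.measurable)

variable [IsProbabilityMeasure P]

theorem aestronglyMeasurable_agentValue_self (hS : IsOpenSystem P lam σ S) (hlam : 0 < lam)
    (i : Fin N) {t : ℝ} (ht : 0 ≤ t) :
    AEStronglyMeasurable[knowledgeSigma S i t] (fun ω => (S ω).agentValue i t) P := by
  refine ⟨_, stronglyMeasurable_comp_knowledgeSet (measurable_recentValue_toReal i) i t, ?_⟩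
  filter_upwards [hS.ae_regular hlam] with ω hω
  obtain ⟨s, hs, hval⟩ := hω.exists_isGreatest_infoTimes_self (i := i) ht
  rw [hω.recentValue_eq hs, hval, EReal.toReal_coe]

theorem aestronglyMeasurable_contactEstimate (hS : IsOpenSystem P lam σ S) (hlam : 0 < lam)
    {i j : Fin N} (hij : i ≠ j) (t : ℝ) :
    AEStronglyMeasurable[knowledgeSigma S i t] (fun ω => contactEstimate lam j i t (S ω)) P := by
  classical
  have hmeas : Measurable[hitMeasurableSpace N] fun K : Set (Info N) =>
      (if recentTime j K = ⊥ then 0 else Real.exp (-lam * (t - (recentTime j K).toReal))) *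
        (recentValue j K).toReal := by
    let _ : MeasurableSpace (Set (Info N)) := hitMeasurableSpace N
    refine Measurable.mul (Measurable.ite (measurable_recentTime j (measurableSet_singleton ⊥))
      measurable_const (Real.measurable_exp.comp
        ((measurable_const.sub (measurable_recentTime j).ereal_toReal).const_mul _))) ?_
    exact measurable_recentValue_toReal j
  refine ⟨_, stronglyMeasurable_comp_knowledgeSet hmeas i t, ?_⟩
  filter_upwards [hS.ae_regular hlam] with ω hω
  rw [hω.recentTime_eq_lastContact hij, contactEstimate, discount, Set.indicator_apply]
  by_cases h : (S ω).lastContact j i t = ⊥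
  · simp [h]
  · obtain ⟨s, hs, -, -, hg⟩ := hω.exists_lastContact hij h
    rw [if_pos (show S ω ∈ {ε : Scenario N | ε.lastContact j i t ≠ ⊥} from h), if_neg h,
      hω.recentValue_eq hg, hs, EReal.toReal_coe, EReal.toReal_coe]

/-- The estimate is split by the holder at the last contact and the true value by the holder at t.
The m-th terms agree, because a holder who arrived after the contact contributes nothing. -/
theorem setIntegral_contactEstimate (hS : IsOpenSystem P lam σ S) (hlam : 0 < lam)
    {i j : Fin N} (hij : i ≠ j) (t : ℝ) {A : Set (Set (Info N))}
    (hA : MeasurableSet[hitMeasurableSpace N] A) :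
    ∫ ω in S ⁻¹' {ε | ε.knowledgeSet i t ∈ A}, contactEstimate lam j i t (S ω) ∂P =
      ∫ ω in S ⁻¹' {ε | ε.knowledgeSet i t ∈ A}, (S ω).agentValue j t ∂P := by
  have hm := hS.measurable
  set K : Set (Scenario N) := {ε | ε.knowledgeSet i t ∈ A} with hK
  let E : ℕ → Set (Scenario N) := fun m => {ε | ε.numRepl j t = m}
  let C : ℕ → Set (Scenario N) := fun m => {ε | ε.lastContact j i t ≠ ⊥ ∧
    ε.numRepl j (ε.lastContact j i t).toReal = m}
  have hKm : MeasurableSet K := measurable_knowledgeSet i t hA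
  have hEm : ∀ m, MeasurableSet (E m) := fun m =>
    measurable_numRepl_apply j t (measurableSet_singleton m)
  have hCm : ∀ m, MeasurableSet (C m) := measurableSet_numRepl_lastContact_eq j i t
  have hxint : Integrable (fun ω => (S ω).agentValue j t) P :=
    (hS.integral_agentValue_sq j t).1.integrable (by norm_num)
  have hgint : Integrable (fun ω => contactEstimate lam j i t (S ω)) P :=
    (hS.integral_contactEstimate_sq hlam j i t).1.integrable (by norm_num)
  have hK1 : S ⁻¹' K = ⋃ m, S ⁻¹' (K ∩ E m) := by
    ext ω
    simp [E]
  have hK2 : S ⁻¹' (K ∩ {ε | ε.lastContact j i t ≠ ⊥}) = ⋃ m, S ⁻¹' (K ∩ C m) := by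
    ext ω
    simp [C]
  have hg0 : ∫ ω in S ⁻¹' K, contactEstimate lam j i t (S ω) ∂P =
      ∫ ω in S ⁻¹' (K ∩ {ε | ε.lastContact j i t ≠ ⊥}), contactEstimate lam j i t (S ω) ∂P := by
    refine setIntegral_eq_of_subset_of_forall_sdiff_eq_zero (hm hKm)
      (Set.preimage_mono Set.inter_subset_left) fun ω hω => ?_
    have h : S ω ∉ {ε : Scenario N | ε.lastContact j i t ≠ ⊥} := fun h => hω.2 ⟨hω.1, h⟩
    rw [contactEstimate, discount, Set.indicator_of_notMem h, zero_mul]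
  rw [hg0, hK1, hK2, integral_iUnion (fun m => hm (hKm.inter (hCm m))) ?_ hgint.integrableOn,
    integral_iUnion (fun m => hm (hKm.inter (hEm m))) ?_ hxint.integrableOn]
  · refine tsum_congr fun m => ?_
    have h1 : ∫ ω in S ⁻¹' (K ∩ E m), (S ω).agentValue j t ∂P =
        ∫ ω in S ⁻¹' (K ∩ E m), (S ω).value j m ∂P := by
      refine setIntegral_congr_fun (hm (hKm.inter (hEm m))) fun ω hω => ?_
      have h : (S ω).numRepl j t = m := hω.2
      simp only [agentValue, h]
    have h2 := integral_inter_add_sdiff (μ := P) (f := fun ω => (S ω).value j m)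
      (s := S ⁻¹' (K ∩ E m)) (t := S ⁻¹' (C m)) (hm (hCm m)) (hS.integrable_value j m).integrableOn
    rw [h1, ← h2, ← Set.preimage_inter, ← Set.preimage_sdiff,
      hS.setIntegral_value_eq_zero hlam hij t m hA, add_zero,
      hS.setIntegral_value_eq_discount hlam hij t m hA]
  · intro m n hmn
    refine Set.disjoint_left.2 fun ω h1 h2 => hmn ?_
    exact h1.2.symm.trans h2.2
  · intro m n hmn
    refine Set.disjoint_left.2 fun ω h1 h2 => hmn ?_
    exact h1.2.2.symm.trans h2.2.2

theorem contactEstimate_ae_eq_condExp (hS : IsOpenSystem P lam σ S) (hlam : 0 < lam)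
    {i j : Fin N} (hij : i ≠ j) (t : ℝ) :
    (fun ω => contactEstimate lam j i t (S ω)) =ᵐ[P]
      P[fun ω => (S ω).agentValue j t | knowledgeSigma S i t] := by
  have hgint : Integrable (fun ω => contactEstimate lam j i t (S ω)) P :=
    (hS.integral_contactEstimate_sq hlam j i t).1.integrable (by norm_num)
  refine ae_eq_condExp_of_forall_setIntegral_eq (hS.knowledgeSigma_le i t)
    ((hS.integral_agentValue_sq j t).1.integrable (by norm_num))
    (fun s _ _ => hgint.integrableOn) ?_ (hS.aestronglyMeasurable_contactEstimate hlam hij t)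
  rintro _ ⟨A, hA, rfl⟩ -
  exact hS.setIntegral_contactEstimate hlam hij t hA

theorem integrable_singleError (hS : IsOpenSystem P lam σ S) (j i : Fin N) (t : ℝ) :
    Integrable (singleError P S j i t) P :=
  ((hS.integral_agentValue_sq j t).1.sub
    ((hS.integral_agentValue_sq j t).1.condExp one_le_two)).integrable_sq

theorem integral_singleError (hS : IsOpenSystem P lam σ S) (hlam : 0 < lam) {i j : Fin N}
    (hij : i ≠ j) (t : ℝ) :
    ∫ ω, singleError P S j i t ω ∂P =
      (1 - ∫ ω, discount (2 * lam) j i t (S ω) ∂P) * σ ^ 2 := by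
  have hm := hS.knowledgeSigma_le i t
  obtain ⟨hx, hx2⟩ := hS.integral_agentValue_sq j t
  obtain ⟨hg, hg2⟩ := hS.integral_contactEstimate_sq hlam j i t
  -- Up to conditioning, the squared error is the conditional variance.
  have h1 : ∫ ω, singleError P S j i t ω ∂P =
      ∫ ω, (Var[fun ω => (S ω).agentValue j t; P | knowledgeSigma S i t]) ω ∂P :=
    (integral_condExp hm).symm
  have h2 := condVar_ae_eq_condExp_sq_sub_sq_condExp hm hx
  have h3 : Var[fun ω => (S ω).agentValue j t; P | knowledgeSigma S i t] =ᵐ[P] fun ω =>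
      (P[(fun ω => (S ω).agentValue j t) ^ 2 | knowledgeSigma S i t]) ω -
        contactEstimate lam j i t (S ω) ^ 2 := by
    filter_upwards [h2, hS.contactEstimate_ae_eq_condExp hlam hij t] with ω h h'
    rw [h, h']
    rfl
  rw [h1, integral_congr_ae h3, integral_sub integrable_condExp hg.integrable_sq,
    integral_condExp hm, hg2]
  simp only [Pi.pow_apply, hx2]
  ring

theorem integral_singleError_self (hS : IsOpenSystem P lam σ S) (hlam : 0 < lam) (i : Fin N)
    {t : ℝ} (ht : 0 ≤ t) : ∫ ω, singleError P S i i t ω ∂P = 0 := by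
  have h := condExp_of_aestronglyMeasurable' (hS.knowledgeSigma_le i t)
    (hS.aestronglyMeasurable_agentValue_self hlam i ht)
    ((hS.integral_agentValue_sq i t).1.integrable (by norm_num))
  refine integral_eq_zero_of_ae ?_
  filter_upwards [h] with ω hω
  simp [singleError, hω]

/-! ### The age distribution -/

theorem pseudoCDF_eq (hS : IsOpenSystem P lam σ S) (hlam : 0 < lam) {i j : Fin N}
    (hij : i ≠ j) (t s : ℝ) :
    pseudoCDF P S j i t s = P.real {ω | (S ω).lastContact j i t ≠ ⊥ ∧
      t - ((S ω).lastContact j i t).toReal ≤ s} := by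
  refine measureReal_congr ?_
  filter_upwards [hS.ae_regular hlam] with ω hω
  exact propext (hω.age_le_iff hij)

/-- With T = t - L, write exp(-rT) as exp(-rt) plus the integral of r exp(-rs) from T to t, then
exchange the integrals. This needs no density. -/
theorem integral_discount (hS : IsOpenSystem P lam σ S) (hlam : 0 < lam) {i j : Fin N}
    (hij : i ≠ j) {t : ℝ} (ht : 0 ≤ t) {r : ℝ} :
    ∫ ω, discount r j i t (S ω) ∂P = pseudoCDF P S j i t t * Real.exp (-r * t) +
      ∫ s in (0 : ℝ)..t, pseudoCDF P S j i t s * (r * Real.exp (-r * s)) := by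
  classical
  have hm := hS.measurable
  let T : Ω → ℝ := fun ω => t - ((S ω).lastContact j i t).toReal
  have hT : Measurable T :=
    measurable_const.sub (((measurable_lastContact j i t).comp hm).ereal_toReal)
  let D : Set Ω := {ω | (S ω).lastContact j i t ≠ ⊥}
  have hD : MeasurableSet D := hm (measurableSet_lastContact_ne_bot j i t)
  have hDT : ∀ s, MeasurableSet {ω | ω ∈ D ∧ T ω ≤ s} := fun s =>
    hD.inter (measurableSet_le hT measurable_const)
  let h : Ω → ℝ → ℝ := fun ω s => if ω ∈ D ∧ T ω ≤ s then r * Real.exp (-r * s) else 0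
  have hF : ∀ s c, ∫ ω, (if ω ∈ D ∧ T ω ≤ s then c else 0) ∂P = pseudoCDF P S j i t s * c := by
    intro s c
    rw [hS.pseudoCDF_eq hlam hij]
    have : (fun ω => if ω ∈ D ∧ T ω ≤ s then c else 0) =
        {ω | ω ∈ D ∧ T ω ≤ s}.indicator fun _ => c := by
      ext ω
      simp [Set.indicator_apply]
    rw [this, integral_indicator_const _ (hDT s), smul_eq_mul]
    rfl
  have hmeas : Measurable (Function.uncurry h) := by
    refine Measurable.ite ((measurable_fst hD).inter
      (measurableSet_le (hT.comp measurable_fst) measurable_snd)) ?_ measurable_const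
    fun_prop
  have hint : Integrable (Function.uncurry h) (P.prod (volume.restrict (Set.Ioc 0 t))) := by
    have hexp : Integrable (fun s => r * Real.exp (-r * s)) (volume.restrict (Set.Ioc 0 t)) := by
      refine (Continuous.integrableOn_Icc (by fun_prop)).mono_set Set.Ioc_subset_Icc_self
    refine (hexp.comp_snd P).mono hmeas.aestronglyMeasurable (.of_forall fun p => ?_)
    simp only [Function.uncurry, h]
    split_ifs
    · exact le_rfl
    · rw [norm_zero]
      exact norm_nonneg _
  have hpt : ∀ᵐ ω ∂P, discount r j i t (S ω) =
      (if ω ∈ D ∧ T ω ≤ t then Real.exp (-r * t) else 0) + ∫ s in Set.Ioc 0 t, h ω s := by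
    filter_upwards [hS.ae_regular hlam] with ω hω
    rw [show discount r j i t (S ω) = if ω ∈ D then Real.exp (-r * T ω) else 0 from
      Set.indicator_apply _ _ _]
    by_cases hd : ω ∈ D
    swap
    · rw [if_neg hd, if_neg (fun h => hd h.1)]
      simp [h, hd]
    · obtain ⟨v, hv, hv0, hvt, -⟩ := hω.exists_lastContact hij hd
      have hTv : T ω = t - v := by simp only [T, hv, EReal.toReal_coe]
      have hT0 : 0 ≤ T ω := by linarith
      have hTt : T ω ≤ t := by linarith
      rw [if_pos hd, if_pos ⟨hd, hTt⟩, ← intervalIntegral.integral_of_le ht]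
      have hc : Continuous fun s => r * Real.exp (-r * s) := by fun_prop
      -- The integrand vanishes before T; the endpoint s = T is a null set.
      have h1 : ∫ s in (0 : ℝ)..T ω, h ω s = 0 := by
        refine intervalIntegral.integral_zero_ae ?_
        filter_upwards [Measure.ae_ne volume (T ω)] with s hs hs'
        rw [Set.uIoc_of_le hT0] at hs'
        exact if_neg fun h => hs (hs'.2.antisymm h.2)
      have h2 : ∫ s in T ω..t, h ω s = ∫ s in T ω..t, r * Real.exp (-r * s) := by
        refine intervalIntegral.integral_congr fun s hs => ?_
        rw [Set.uIcc_of_le hTt] at hs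
        exact if_pos ⟨hd, hs.1⟩
      have h3 : ∫ s in T ω..t, r * Real.exp (-r * s) =
          -Real.exp (-r * t) - -Real.exp (-r * T ω) := by
        refine intervalIntegral.integral_eq_sub_of_hasDerivAt (f := fun s => -Real.exp (-r * s))
          (fun s _ => ?_) (hc.intervalIntegrable _ _)
        have := (((hasDerivAt_id s).const_mul (-r)).exp).neg
        convert! this using 1
        simp only [id, mul_one]
        ring
      have hi : ∀ a b, IntervalIntegrable (h ω) volume a b := by
        intro a b
        refine (hc.intervalIntegrable a b).mono_fun
          (hmeas.comp measurable_prodMk_left).aestronglyMeasurable (.of_forall fun s => ?_)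
        simp only [h]
        split_ifs
        · exact le_rfl
        · rw [norm_zero]
          exact norm_nonneg _
      rw [← intervalIntegral.integral_add_adjacent_intervals (hi 0 (T ω)) (hi (T ω) t), h1, h2, h3]
      ring
  rw [integral_congr_ae hpt, integral_add, hF, integral_integral_swap hint,
    intervalIntegral.integral_of_le ht]
  · congr 1
    refine integral_congr_ae (.of_forall fun s => ?_)
    exact hF s _
  · refine Integrable.of_bound (C := Real.exp (-r * t)) (Measurable.ite (hDT t) measurable_const
      measurable_const).aestronglyMeasurable (.of_forall fun ω => ?_)
    split_ifs
    · simp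
    · simp [Real.exp_nonneg]
  · exact hint.integral_prod_left

theorem pseudoCDF_of_neg (hS : IsOpenSystem P lam σ S) (hlam : 0 < lam) {i j : Fin N}
    (hij : i ≠ j) (t : ℝ) {s : ℝ} (hs : s < 0) : pseudoCDF P S j i t s = 0 := by
  rw [hS.pseudoCDF_eq hlam hij, measureReal_eq_zero_iff]
  rw [← compl_mem_ae_iff]
  filter_upwards [hS.ae_regular hlam] with ω _ h
  linarith [toReal_lastContact_le h.1, h.2]

theorem integral_pseudoPDF (hS : IsOpenSystem P lam σ S) (hlam : 0 < lam) {i j : Fin N}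
    (hij : i ≠ j) {t : ℝ} (ht : 0 ≤ t) (r : ℝ)
    (hac : ∀ a b : ℝ, AbsolutelyContinuousOnInterval (pseudoCDF P S j i t) a b) :
    ∫ s in (0 : ℝ)..t, pseudoPDF P S j i t s * Real.exp (-r * s) =
      ∫ ω, discount r j i t (S ω) ∂P := by
  -- An atom at age 0 is excluded by continuity from the left, as ages are never negative. This
  -- removes the boundary term at 0 in the integration by parts.
  have h0 : pseudoCDF P S j i t 0 = 0 := by
    have hc : ContinuousWithinAt (pseudoCDF P S j i t) (Set.Iio 0) 0 :=
      (((hac (-1) 1).continuousOn).continuousAt (by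
        rw [Set.uIcc_of_le (by norm_num)]
        exact Icc_mem_nhds (by norm_num) (by norm_num))).continuousWithinAt
    refine tendsto_nhds_unique hc (tendsto_const_nhds.congr' ?_)
    filter_upwards [self_mem_nhdsWithin] with s hs
    exact (hS.pseudoCDF_of_neg hlam hij t hs).symm
  have hder : ∀ s, deriv (fun s => Real.exp (-r * s)) s = -(r * Real.exp (-r * s)) := by
    intro s
    rw [(((hasDerivAt_id' s).const_mul (-r)).exp).deriv]
    ring
  have hexp : AbsolutelyContinuousOnInterval (fun s => Real.exp (-r * s)) 0 t :=
    ContDiffOn.absolutelyContinuousOnInterval (by fun_prop)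
  have h := (hac 0 t).integral_mul_deriv_eq_deriv_mul hexp
  simp only [hder, mul_neg, intervalIntegral.integral_neg, h0, zero_mul, sub_zero] at h
  rw [hS.integral_discount hlam hij ht]
  simp only [pseudoPDF]
  simp only [neg_mul] at h ⊢
  linarith

end IsOpenSystem

end Random

theorem mainTheorem7 {Ω : Type*} [mΩ : MeasurableSpace Ω] (P : Measure Ω) [IsProbabilityMeasure P]
    {N : ℕ} (lam σ : ℝ) (hlam : 0 < lam) (S : Ω → Scenario N) (hS : IsOpenSystem P lam σ S)
    (i j : Fin N) (t : ℝ) (ht : 0 ≤ t) :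
    knowledgeSigma S i t ≤ mΩ ∧
    Integrable (singleError P S j i t) P ∧
    (j ≠ i → (∀ a b : ℝ, AbsolutelyContinuousOnInterval (pseudoCDF P S j i t) a b) →
      ∫ ω, singleError P S j i t ω ∂P =
        (1 - ∫ s in (0 : ℝ)..t, pseudoPDF P S j i t s * Real.exp (-2 * lam * s)) * σ ^ 2) ∧
    (j = i → ∫ ω, singleError P S j i t ω ∂P = 0) := by
  refine ⟨hS.knowledgeSigma_le i t, hS.integrable_singleError j i t, fun hji hac => ?_, ?_⟩
  · rw [hS.integral_singleError hlam hji.symm t,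
      ← hS.integral_pseudoPDF hlam hji.symm ht (2 * lam) hac]
    simp only [neg_mul]
  · rintro rfl
    exact hS.integral_singleError_self hlam j ht
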